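/- Let $\Lambda$ be a finite graph with $N$ sites, let $\mathcal H=\bigotimes_{x\in\Lambda}\mathbb C^d$, and let $\mathfrak h^s\subseteq\mathbb C^d$ be a subspace of dimension $d_s=r+1\ge 1$. Let $H^1,\dots,H^r$ be linearly independent, traceless, Hermitian operators on $\mathfrak h^s$ (a basis of a Cartan subalgebra of $\mathfrak{su}(\mathfrak h^s)\otimes\mathbb{C}$), extended by $0$ to $(\mathfrak h^s)^\perp$, that are simultaneously diagonal in an orthonormal basis $|0\rangle,\dots,|r\rangle$ of $\mathfrak h^s$: $H^i|k\rangle=m_k^i|k\rangle$. Let $H^i_x$ denote $H^i$ acting on site $x$, and let $H_X^i=\sum_{x\in X}H_x^i$. Let $P^s$ be the orthogonal projector onto $\mathfrak h^s$ and $P_X^s=\bigotimes_{x\in X}P_x^s$, acting as the identity off $X$. Let $\mathrm{Sym}^N(\mathfrak h^s)$ be the space of permutation-invariant vectors in $\bigotimes_x\mathfrak h^s$. For $k:\Lambda\to\{0,\dots,r\}$ let $\psi_k\propto\sum_{\sigma\in\mathfrak S_\Lambda}\bigotimes_{x}|k_{\sigma(x)}\rangle$ be the totally symmetric weight basis state of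 total weight $m^i(k)=\sum_x m^i_{k_x}$. Let $H=\sum_{X\subseteq\Lambda}h_X$, where $h_X$ acts non-trivially only on the sites of $X$. Call $X$ an interaction region if $h_X\neq0$, and assume that $H$ is local: every interaction region is (non-empty and) connected, and the interaction is not all-to-all, i.e. if $N\ge2$ then there are two distinct sites that lie in no common interaction region. Assume that every $\psi_k$ is an eigenvector of $H$, and that each $P_X^sh_XP_X^s$ is weight preserving: $[P_X^sh_XP_X^s,H_X^i]=0$ for all $X$ and $i$. For $x\in\Lambda$ let $U_x$ be the union of all interaction regions that meet an interaction region containing $x$ (so if all interaction regions have diameter at most $R$, then $U_x$ lies in the ball of radius $2R$ about $x$). Then $$H=\sum_{x\in\Lambda}h^{(1)}_{[x]}P^{(1)}_x+\sum_{\langle x,y\rangle}h^{(2)}_{[xy]}P^{(2)}_{xy}+\sum_{x\in\Lambda}h_x,\qquad h_x=\sum_{i=1}^{r}b_iH_x^i+c ,$$ with $b_1,\dots,b_r,c\in\mathbb C$ independent of $x$, where the second sum runs over the edges of $\Lambda$; $P^{(1)}_x$ and $P^{(2)}_{xy}$ are orthogonal projectors acting non-trivially only on $x$ and on $\{x,y\}$,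 respectively, each of which annihilates $\mathrm{Sym}^N(\mathfrak h^s)$; and the coefficients are strictly local: $h^{(1)}_{[x]}$ acts non-trivially only on $U_x$ and $h^{(2)}_{[xy]}$ only on $U_x\cap U_y$. If $H$ is Hermitian, then so is the Zeeman term $Z=\sum_xh_x$. The Zeeman term alone determines the scar energies: for every $k$, $$H\psi_k=Z\psi_k=\Big(\sum_{i=1}^r b_i\,m^i(k)+Nc\Big)\psi_k .$$ -/

import Mathlib

namespace FerroScar

/-- States of the many-body Hilbert space `⨂_{x ∈ Λ} ℂ^d`, written in the product basis: the basis
is indexed by the configurations `Λ → Fin d`. -/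
abbrev State (Λ : Type*) (d : ℕ) : Type _ := (Λ → Fin d) → ℂ

/-- Operators on `⨂_{x ∈ Λ} ℂ^d`, as matrices in the product basis. -/
abbrev Op (Λ : Type*) (d : ℕ) : Type _ := Matrix (Λ → Fin d) (Λ → Fin d) ℂ

/-- The product state `⨂_x v_x`. -/
def productState {Λ : Type*} [Fintype Λ] {d : ℕ} (v : Λ → EuclideanSpace ℂ (Fin d)) : State Λ d :=
  fun n => ∏ x, v x (n x)

/-- The permutation operator; it sends `⨂_x v_x` to `⨂_x v_{σ x}`. -/
def permute {Λ : Type*} {d : ℕ} (σ : Equiv.Perm Λ) (ψ : State Λ d) : State Λ d :=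
  fun n => ψ (n ∘ σ.symm)

/-- The product operator `⨂_x A_x`. -/
def productOp {Λ : Type*} [Fintype Λ] {d : ℕ} (A : Λ → Matrix (Fin d) (Fin d) ℂ) : Op Λ d :=
  Matrix.of fun n n' => ∏ x, A x (n x) (n' x)

/-- The operator that acts as `A` on site `x` and as the identity on all other sites. -/
def siteOp {Λ : Type*} [Fintype Λ] [DecidableEq Λ] {d : ℕ} (x : Λ)
    (A : Matrix (Fin d) (Fin d) ℂ) : Op Λ d :=
  productOp (Function.update (fun _ => 1) x A)

open Classical in
/-- The operator `A ⊗ 1` that acts as `A` on the sites in `X` and as the identity off `X`. -/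
noncomputable def embed {Λ : Type*} {d : ℕ} (X : Set Λ) (A : Op X d) : Op Λ d :=
  Matrix.of fun n n' =>
    if ∀ y, y ∉ X → n y = n' y then A (fun x => n x) (fun x => n' x) else 0

/-- `O` acts non-trivially only on the sites in `X`. -/
def SupportedOn {Λ : Type*} {d : ℕ} (X : Set Λ) (O : Op Λ d) : Prop :=
  ∃ A : Op X d, O = embed X A

/-- An `(r+1)`-dimensional on-site target space `𝔥ˢ ⊆ ℂ^d` together with a Hermitian basis
`H^1, …, H^r` of a Cartan subalgebra of `𝔰𝔩(𝔥ˢ) = 𝔰𝔲(𝔥ˢ) ⊗ ℂ`. The data are recorded through the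
simultaneous orthonormal eigenbasis `ket k` of `𝔥ˢ` and the eigenvalues,
`H^i (ket k) = weight k i • ket k`. -/
structure TargetSpace (d r : ℕ) where
  /-- the simultaneous eigenstates `|m⟩`, a basis of `𝔥ˢ` -/
  ket : Fin (r + 1) → EuclideanSpace ℂ (Fin d)
  orthonormal : Orthonormal ℂ ket
  /-- the weight vectors of the basis states -/
  weight : Fin (r + 1) → Fin r → ℝ
  /-- the generators `H^i` are traceless -/
  weight_sum : ∀ i, ∑ k, weight k i = 0
  /-- the generators `H^i` are linearly independent -/
  weight_indep : LinearIndependent ℝ (fun (i : Fin r) (k : Fin (r + 1)) => weight k i)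

namespace TargetSpace

variable {d r : ℕ} (T : TargetSpace d r)

/-- The target space `𝔥ˢ` as a subspace of the on-site Hilbert space. -/
def space : Submodule ℂ (EuclideanSpace ℂ (Fin d)) := Submodule.span ℂ (Set.range T.ket)

/-- The rank-one projector `|k⟩⟨k|` on one site. -/
def dyad (k : Fin (r + 1)) : Matrix (Fin d) (Fin d) ℂ :=
  Matrix.of fun a b => T.ket k a * star (T.ket k b)

/-- The orthogonal projector `Pˢ` of the on-site Hilbert space onto `𝔥ˢ`. -/
def proj : Matrix (Fin d) (Fin d) ℂ := ∑ k, T.dyad k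

/-- The Cartan generator `H^i` on one site; it vanishes on the orthogonal complement of `𝔥ˢ`. -/
def cartan (i : Fin r) : Matrix (Fin d) (Fin d) ℂ := ∑ k, (T.weight k i : ℂ) • T.dyad k

variable {Λ : Type*} [Fintype Λ] [DecidableEq Λ]

/-- `P_Xˢ = ⨂_{x ∈ X} P_xˢ`, acting as the identity off `X`. -/
def projOn (X : Finset Λ) : Op Λ d := productOp fun x => if x ∈ X then T.proj else 1

/-- `H_X^i = ∑_{x ∈ X} H_x^i`. -/
def cartanOn (X : Finset Λ) (i : Fin r) : Op Λ d := ∑ x ∈ X, siteOp x (T.cartan i)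

/-- The totally symmetric subspace `Sym^N(𝔥ˢ)`: the permutation-invariant vectors in the span of
the product states with all factors in `𝔥ˢ`. -/
def symSpace (Λ : Type*) [Fintype Λ] : Set (State Λ d) :=
  {ψ | ψ ∈ Submodule.span ℂ {φ | ∃ v : Λ → EuclideanSpace ℂ (Fin d),
      (∀ x, v x ∈ T.space) ∧ φ = productState v} ∧
    ∀ σ : Equiv.Perm Λ, permute σ ψ = ψ}

/-- The totally symmetric weight basis state `∑_σ σ ⨂_x |m_x⟩` of the assignment `x ↦ m_x` of
on-site weights encoded by `k` (without its normalization constant, which does not matter for being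
an eigenstate). It depends on `k` only through the total weight. -/
def weightState (k : Λ → Fin (r + 1)) : State Λ d :=
  ∑ σ : Equiv.Perm Λ, permute σ (productState fun x => T.ket (k x))

/-- The total weight `m^i = ∑_x m_x^i`. -/
def totalWeight (k : Λ → Fin (r + 1)) (i : Fin r) : ℝ := ∑ x, T.weight (k x) i

/-- The Zeeman term `∑_x h_x`, `h_x = ∑_i b_i H_x^i + c`: a site-independent linear combination of
on-site Cartan generators, up to an additive constant. -/
def zeeman (Λ : Type*) [Fintype Λ] [DecidableEq Λ] (b : Fin r → ℂ) (c : ℂ) : Op Λ d :=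
  ∑ x : Λ, (∑ i, b i • siteOp x (T.cartan i) + c • 1)

/-- `P` is an orthogonal projector, acts only on the sites in `X`, and annihilates `Sym^N(𝔥ˢ)`. -/
def IsLocalAnnihilatingProjector (X : Set Λ) (P : Op Λ d) : Prop :=
  IsStarProjection P ∧ SupportedOn X P ∧ ∀ ψ ∈ T.symSpace Λ, P.mulVec ψ = 0

end TargetSpace

/-- The interaction `X ↦ h_X` is local on the lattice (graph) `G`: every term `h_X` acts only on
`X`, only connected regions `X` carry a non-zero term, and the interaction is not all-to-all, i.e.
(unless there is at most one site) some two sites lie in no common region with a non-zero term. -/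
structure IsLocal {Λ : Type*} {d : ℕ} (G : SimpleGraph Λ) (h : Finset Λ → Op Λ d) : Prop where
  supported : ∀ X : Finset Λ, SupportedOn (X : Set Λ) (h X)
  connected : ∀ X : Finset Λ, h X ≠ 0 → (G.induce (X : Set Λ)).Connected
  not_all_to_all : Nontrivial Λ →
    ∃ x y : Λ, x ≠ y ∧ ∀ X : Finset Λ, h X ≠ 0 → ¬ (x ∈ X ∧ y ∈ X)

/-- The union of all interaction regions that meet an interaction region containing `x`. If all
interaction regions have diameter at most `R`, it lies in the ball of radius `2R` about `x`. -/
def interactionHull {Λ : Type*} {d : ℕ} (h : Finset Λ → Op Λ d) (x : Λ) : Set Λ :=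
  {z | ∃ X Y : Finset Λ, h X ≠ 0 ∧ h Y ≠ 0 ∧ x ∈ X ∧ z ∈ Y ∧ ∃ w, w ∈ X ∧ w ∈ Y}

end FerroScar

open FerroScar

/-! Write `v^⊗N` for the product state with the same factor `v ∈ 𝔥ˢ` on every site. The engine is
`decomposes_of_annihilates`: an operator `O` on a connected region `V` that kills every `v^⊗N` is a
combination, with coefficients on `V`, of leakage projectors `1 - Pˢ` at the sites of `V` and
exchange-odd projectors on the edges inside `V`. A vector killed by all these projectors is
`𝔥ˢ`-valued on `V` and, since transpositions along edges generate all permutations of `V`, symmetric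
there; polarization then shows that `O` kills it. Hence `O` vanishes on the kernel of the sum `M` of
the projectors, and `O = O R M` with `R` a polynomial in `M`, so `O R` stays on `V`.

It remains to write `H - Z` as a sum of such operators.

Leakage (`decomposes_sub_sum_projOn_mul`): `H` sends `v^⊗N` to a combination of weight states, so
its total leakage at a site `y` vanishes. Terms not containing `y` do not leak there, so the terms
containing `y` must cancel among themselves. They live on the union of the regions through `y`,
which is connected; this union is the reason for `U_x`. Treating the sites one by one replaces each
`h_X` by `P_X h_X`.

Diagonalization (`projOn_mul_mulVec_eq_diagOp`): a weight-preserving term connects only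
configurations with equal occupation numbers, which have equal coefficients in `v^⊗N`. So `P_X h_X`
acts on every `v^⊗N` as a diagonal operator, whose entries depend only on the labels in `X`.

Additivity (`exists_amplitude_eq_sum`): the summed diagonal entries are permutation invariant
because `H` preserves symmetric states. Two sites in no common region are uncorrelated in this sum;
by symmetry no two sites are correlated, so the entries are `∑ ε (n x)`. Any function `ε` of the
label is affine in the weights, which gives the Zeeman term up to leakage projectors.

The projectors kill the weight states, so the Zeeman term alone gives the energies. Real energies of
the polarized states make it Hermitian. -/

namespace FerroScar

open Function Finset

/-! ### Polarization, and left ideals generated by projectors -/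

section LinearAlgebra

open scoped ComplexOrder

/-- Polarization: a multilinear map that vanishes on the diagonal of `W` has vanishing
symmetrization on `W`. -/
theorem sum_perm_eq_zero_of_diagonal {ι E F : Type*} [Fintype ι] [DecidableEq ι]
    [AddCommGroup E] [Module ℂ E] [AddCommGroup F] [Module ℂ F]
    (f : MultilinearMap ℂ (fun _ : ι => E) F) (W : Submodule ℂ E)
    (hf : ∀ v ∈ W, f (fun _ => v) = 0) (u : ι → E) (hu : ∀ i, u i ∈ W) :
    ∑ σ : Equiv.Perm ι, f (u ∘ σ) = 0 := by
  classical
  -- Inclusion-exclusion over the values missed by a map `ι → ι`: the maps missing nothing are the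
  -- permutations. The maps missing all of `t` contribute `f` at the diagonal point `∑ i ∈ tᶜ, u i ∈
  -- W`, hence zero.
  have key := Finset.inclusion_exclusion_sum_inf_compl (Finset.univ : Finset ι)
    (fun i => (Finset.univ.filter fun g : ι → ι => ∀ j, g j ≠ i)) (fun g => f (u ∘ g))
  have hR : ∀ t : Finset ι,
      ∑ a ∈ t.inf (fun i => (Finset.univ.filter fun g : ι → ι => ∀ j, g j ≠ i)), f (u ∘ a) = 0 := by
    intro t
    have h1 : t.inf (fun i => (Finset.univ.filter fun g : ι → ι => ∀ j, g j ≠ i))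
        = Fintype.piFinset (fun _ : ι => tᶜ) := by
      ext g
      simp only [Finset.mem_inf, Finset.mem_filter, Finset.mem_univ, true_and,
        Fintype.mem_piFinset, Finset.mem_compl]
      exact ⟨fun h a ha => h _ ha a rfl, fun h i hi j hj => h j (hj ▸ hi)⟩
    rw [h1]
    have h2 := f.map_sum_finset (fun _ j => u j) (fun _ => tᶜ)
    rw [hf _ (Submodule.sum_mem _ fun i _ => hu i)] at h2
    exact h2.symm
  simp only [hR, smul_zero, Finset.sum_const_zero] at key
  rw [← key]
  refine Finset.sum_bij (fun σ _ => (σ : ι → ι)) ?_ ?_ ?_ ?_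
  · intro σ _
    simp only [Finset.mem_inf, Finset.mem_compl, Finset.mem_filter, Finset.mem_univ, true_and]
    intro i _ h
    exact h (σ.symm i) (by simp)
  · intro σ _ τ _ h
    exact Equiv.coe_fn_injective h
  · intro g hg
    simp only [Finset.mem_inf, Finset.mem_compl, Finset.mem_filter, Finset.mem_univ, true_and,
      not_forall, not_not] at hg
    have hs : Surjective g := fun i => hg i trivial
    exact ⟨Equiv.ofBijective g (Finite.surjective_iff_bijective.mp hs), Finset.mem_univ _, rfl⟩
  · intros; rfl

/-- A matrix that vanishes on the common kernel of finitely many orthogonal projectors lies in the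
left ideal they generate; the coefficient can be chosen in the algebra generated by their sum. -/
theorem exists_eq_sum_mul_of_common_kernel {ι m : Type*} [Fintype m] [DecidableEq m]
    (s : Finset ι) (P : ι → Matrix m m ℂ) (hP : ∀ i ∈ s, IsStarProjection (P i))
    (O : Matrix m m ℂ)
    (hO : ∀ φ : m → ℂ, (∀ i ∈ s, (P i).mulVec φ = 0) → O.mulVec φ = 0) :
    ∃ R : Matrix m m ℂ, O = ∑ i ∈ s, (O * R) * P i ∧
      ∀ C, (∀ i ∈ s, Commute (P i) C) → Commute R C := by
  set M := ∑ i ∈ s, P i with hM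
  have hMh : M.IsHermitian := by
    rw [Matrix.IsHermitian, hM, Matrix.conjTranspose_sum]
    exact Finset.sum_congr rfl fun i hi => (hP i hi).isSelfAdjoint
  have hker : ∀ φ : m → ℂ, M.mulVec φ = 0 → O.mulVec φ = 0 := by
    intro φ hφ
    apply hO
    have h0 : ∑ i ∈ s, star ((P i).mulVec φ) ⬝ᵥ (P i).mulVec φ = 0 := by
      have h1 : star φ ⬝ᵥ M.mulVec φ = 0 := by rw [hφ, dotProduct_zero]
      rw [hM, Matrix.sum_mulVec, dotProduct_sum] at h1
      rw [← h1]
      refine Finset.sum_congr rfl fun i hi => ?_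
      rw [Matrix.star_mulVec, ← Matrix.dotProduct_mulVec, Matrix.mulVec_mulVec]
      have hs : Matrix.conjTranspose (P i) = P i := (hP i hi).isSelfAdjoint
      rw [hs, (hP i hi).isIdempotentElem.eq]
    have h2 := (Finset.sum_eq_zero_iff_of_nonneg
      (fun i _ => dotProduct_star_self_nonneg _)).mp h0
    intro i hi
    exact dotProduct_star_self_eq_zero.mp (h2 i hi)
  -- Split the characteristic polynomial as `X ^ k * g` with `g 0 ≠ 0`. The image of `g(M)` lies in
  -- the kernel of `M ^ k`, so `O * g(M) = 0`; solving for the constant term of `g` gives `R = -(g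
  -- 0)⁻¹ • g.divX(M)`.
  obtain ⟨g, hg, hnd⟩ := Polynomial.exists_eq_pow_rootMultiplicity_mul_and_not_dvd
    M.charpoly M.charpoly_monic.ne_zero 0
  -- For Hermitian `M`, `M (M χ) = 0` forces `M χ = 0`; this lowers the power of `M` down to one.
  have hpow : ∀ k : ℕ, ∀ φ : m → ℂ, (M ^ k).mulVec φ = 0 → O.mulVec φ = 0 := by
    intro k
    induction k with
    | zero => intro φ h; simp at h; simp [h]
    | succ k ih =>
      intro φ h
      rcases k with _ | k
      · exact hker φ (by simpa using h)
      · apply ih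
        have h3 : M.conjTranspose.mulVec (M.mulVec ((M ^ k).mulVec φ)) = 0 := by
          rw [hMh.eq, Matrix.mulVec_mulVec, Matrix.mulVec_mulVec, ← pow_two, ← pow_add]
          rwa [show 2 + k = k + 1 + 1 by ring]
        have h4 : star (M.mulVec ((M ^ k).mulVec φ)) ⬝ᵥ M.mulVec ((M ^ k).mulVec φ) = 0 := by
          rw [Matrix.star_mulVec, ← Matrix.dotProduct_mulVec, h3, dotProduct_zero]
        have h5 := dotProduct_star_self_eq_zero.mp h4
        rwa [Matrix.mulVec_mulVec, ← pow_succ'] at h5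
  have hOg : O * Polynomial.aeval M g = 0 := by
    have h6 : M ^ (M.charpoly.rootMultiplicity 0) * Polynomial.aeval M g = 0 := by
      have := Matrix.aeval_self_charpoly M
      rw [hg] at this
      simpa using this
    refine Matrix.ext_of_mulVec_single fun i => ?_
    rw [← Matrix.mulVec_mulVec, Matrix.zero_mulVec]
    exact hpow _ _ (by rw [Matrix.mulVec_mulVec, h6, Matrix.zero_mulVec])
  have hc : g.coeff 0 ≠ 0 := by
    intro h0
    apply hnd
    rw [Polynomial.C_0, sub_zero]
    exact Polynomial.X_dvd_iff.mpr h0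
  have hsplit : O * (Polynomial.aeval M g.divX * M) + g.coeff 0 • O = 0 := by
    have h7 := hOg
    rw [← Polynomial.divX_mul_X_add g] at h7
    simpa [mul_add, Algebra.algebraMap_eq_smul_one] using h7
  refine ⟨-(g.coeff 0)⁻¹ • Polynomial.aeval M g.divX, ?_, fun C hC => ?_⟩
  · rw [← Finset.mul_sum, ← hM, mul_assoc, smul_mul_assoc, mul_smul_comm,
      eq_neg_of_add_eq_zero_left hsplit, smul_neg, neg_smul, neg_neg, inv_smul_smul₀ hc]
  · refine Commute.smul_left ?_ _
    have h8 : Algebra.adjoin ℂ {M} ≤ Subalgebra.centralizer ℂ {C} := by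
      rw [Algebra.adjoin_le_iff, Set.singleton_subset_iff]
      simp only [SetLike.mem_coe, Subalgebra.mem_centralizer_iff, Set.mem_singleton_iff,
        forall_eq]
      exact (Commute.sum_left s P C hC).eq.symm
    have h9 := h8 (Polynomial.aeval_mem_adjoin_singleton ℂ M (p := g.divX))
    rw [Subalgebra.mem_centralizer_iff] at h9
    exact (h9 C rfl).symm

end LinearAlgebra

end FerroScar

namespace FerroScar

open Function Finset Matrix

/-! ### Product vectors, product operators and the commutant description of support -/

section Tensor

variable {Λ : Type*} [Fintype Λ] {d : ℕ}

/-- The product vector `⨂_x v_x`, for plain coordinate vectors `v_x`. -/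
def tensorVec (v : Λ → Fin d → ℂ) : State Λ d := fun n => ∏ x, v x (n x)

theorem sum_prod_pi [DecidableEq Λ] {κ : Type*} [Fintype κ] (f : Λ → κ → ℂ) :
    ∑ n : Λ → κ, ∏ x, f x (n x) = ∏ x, ∑ a, f x a := by
  rw [Finset.prod_univ_sum, Fintype.piFinset_univ]

theorem productOp_mulVec [DecidableEq Λ] (A : Λ → Matrix (Fin d) (Fin d) ℂ) (v : Λ → Fin d → ℂ) :
    productOp A *ᵥ tensorVec v = tensorVec fun x => A x *ᵥ v x := by
  ext n
  simp only [mulVec, dotProduct, productOp, Matrix.of_apply, tensorVec, ← Finset.prod_mul_distrib]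
  exact sum_prod_pi fun x a => A x (n x) a * v x a

theorem vecMul_productOp [DecidableEq Λ] (A : Λ → Matrix (Fin d) (Fin d) ℂ) (v : Λ → Fin d → ℂ) :
    tensorVec v ᵥ* productOp A = tensorVec fun x => v x ᵥ* A x := by
  ext n
  simp only [vecMul, dotProduct, productOp, Matrix.of_apply, tensorVec, ← Finset.prod_mul_distrib]
  exact sum_prod_pi fun x a => v x a * A x a (n x)

theorem tensorVec_dotProduct [DecidableEq Λ] (v w : Λ → Fin d → ℂ) :
    tensorVec v ⬝ᵥ tensorVec w = ∏ x, v x ⬝ᵥ w x := by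
  simp only [dotProduct, tensorVec, ← Finset.prod_mul_distrib]
  exact sum_prod_pi fun x a => v x a * w x a

theorem productOp_mul [DecidableEq Λ] (A B : Λ → Matrix (Fin d) (Fin d) ℂ) :
    productOp A * productOp B = productOp fun x => A x * B x := by
  ext n n'
  simp only [Matrix.mul_apply, productOp, Matrix.of_apply, ← Finset.prod_mul_distrib]
  exact sum_prod_pi fun x a => A x (n x) a * B x a (n' x)

theorem productOp_one : productOp (fun _ : Λ => (1 : Matrix (Fin d) (Fin d) ℂ)) = 1 := by
  ext n n'
  simp only [productOp, Matrix.of_apply, Matrix.one_apply]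
  by_cases h : n = n'
  · simp [h]
  · obtain ⟨x, hx⟩ := Function.ne_iff.mp h
    rw [if_neg h]
    exact Finset.prod_eq_zero (Finset.mem_univ x) (if_neg hx)

theorem productOp_conjTranspose (A : Λ → Matrix (Fin d) (Fin d) ℂ) :
    (productOp A)ᴴ = productOp fun x => (A x)ᴴ := by
  ext n n'
  simp [productOp, Matrix.conjTranspose_apply]

/-- `⨂_x A_x` as a multilinear function of its factors. -/
def productOpMultilinear (Λ : Type*) [Fintype Λ] (d : ℕ) :
    MultilinearMap ℂ (fun _ : Λ => Matrix (Fin d) (Fin d) ℂ) (Op Λ d) where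
  toFun := productOp
  map_update_add' A x B C := by
    ext n n'
    simp only [productOp, Matrix.of_apply, Matrix.add_apply, Fintype.prod_eq_mul_prod_compl x,
      Function.update_self]
    rw [add_mul]
    congr 2 <;> refine Finset.prod_congr rfl fun y hy => ?_ <;>
      simp [Function.update_of_ne (by simpa using hy : y ≠ x)]
  map_update_smul' A x c B := by
    ext n n'
    simp only [productOp, Matrix.of_apply, Matrix.smul_apply, Fintype.prod_eq_mul_prod_compl x,
      Function.update_self, smul_eq_mul]
    rw [mul_assoc]
    congr 2
    refine Finset.prod_congr rfl fun y hy => ?_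
    simp [Function.update_of_ne (by simpa using hy : y ≠ x)]

/-- `⨂_x v_x` as a multilinear function of its factors. -/
def tensorVecMultilinear (Λ : Type*) [Fintype Λ] (d : ℕ) :
    MultilinearMap ℂ (fun _ : Λ => Fin d → ℂ) (State Λ d) where
  toFun := tensorVec
  map_update_add' A x B C := by
    ext n
    simp only [tensorVec, Pi.add_apply, Fintype.prod_eq_mul_prod_compl x,
      Function.update_self]
    rw [add_mul]
    congr 2 <;> refine Finset.prod_congr rfl fun y hy => ?_ <;>
      simp [Function.update_of_ne (by simpa using hy : y ≠ x)]
  map_update_smul' A x c B := by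
    ext n
    simp only [tensorVec, Pi.smul_apply, Fintype.prod_eq_mul_prod_compl x,
      Function.update_self, smul_eq_mul]
    rw [mul_assoc]
    congr 2
    refine Finset.prod_congr rfl fun y hy => ?_
    simp [Function.update_of_ne (by simpa using hy : y ≠ x)]

variable [DecidableEq Λ]

theorem siteOp_add (x : Λ) (A B : Matrix (Fin d) (Fin d) ℂ) :
    siteOp x (A + B) = siteOp x A + siteOp x B :=
  (productOpMultilinear Λ d).map_update_add _ x A B

theorem siteOp_smul (x : Λ) (c : ℂ) (A : Matrix (Fin d) (Fin d) ℂ) :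
    siteOp x (c • A) = c • siteOp x A :=
  (productOpMultilinear Λ d).map_update_smul _ x c A

theorem siteOp_sum {ι : Type*} (s : Finset ι) (x : Λ) (A : ι → Matrix (Fin d) (Fin d) ℂ) :
    siteOp x (∑ i ∈ s, A i) = ∑ i ∈ s, siteOp x (A i) :=
  (productOpMultilinear Λ d).map_update_sum s x A _

theorem siteOp_one (x : Λ) : siteOp x (1 : Matrix (Fin d) (Fin d) ℂ) = 1 := by
  rw [siteOp, ← productOp_one]
  congr 1
  exact Function.update_eq_self x fun _ => (1 : Matrix (Fin d) (Fin d) ℂ)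

theorem siteOp_sub (x : Λ) (A B : Matrix (Fin d) (Fin d) ℂ) :
    siteOp x (A - B) = siteOp x A - siteOp x B :=
  (productOpMultilinear Λ d).map_update_sub _ x A B

theorem siteOp_mul (x : Λ) (A B : Matrix (Fin d) (Fin d) ℂ) :
    siteOp x A * siteOp x B = siteOp x (A * B) := by
  rw [siteOp, siteOp, siteOp, productOp_mul]
  congr 1
  ext1 z
  by_cases h : z = x
  · subst h; simp
  · simp [Function.update_of_ne h]

theorem siteOp_conjTranspose (x : Λ) (A : Matrix (Fin d) (Fin d) ℂ) :
    (siteOp x A)ᴴ = siteOp x Aᴴ := by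
  rw [siteOp, siteOp, productOp_conjTranspose]
  congr 1
  ext1 z
  by_cases h : z = x
  · subst h; simp
  · simp [Function.update_of_ne h]

theorem siteOp_mulVec (x : Λ) (A : Matrix (Fin d) (Fin d) ℂ) (v : Λ → Fin d → ℂ) :
    siteOp x A *ᵥ tensorVec v = tensorVec (Function.update v x (A *ᵥ v x)) := by
  rw [siteOp, productOp_mulVec]
  congr 1
  ext1 z
  by_cases h : z = x
  · subst h; simp
  · simp [Function.update_of_ne h]

theorem vecMul_siteOp (x : Λ) (A : Matrix (Fin d) (Fin d) ℂ) (v : Λ → Fin d → ℂ) :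
    tensorVec v ᵥ* siteOp x A = tensorVec (Function.update v x (v x ᵥ* A)) := by
  rw [siteOp, vecMul_productOp]
  congr 1
  ext1 z
  by_cases h : z = x
  · subst h; simp
  · simp [Function.update_of_ne h]

theorem commute_productOp_siteOp {A : Λ → Matrix (Fin d) (Fin d) ℂ} {x : Λ}
    {B : Matrix (Fin d) (Fin d) ℂ} (h : Commute (A x) B) :
    Commute (productOp A) (siteOp x B) := by
  rw [Commute, SemiconjBy, siteOp, productOp_mul, productOp_mul]
  congr 1
  ext1 z
  by_cases hz : z = x
  · subst hz; simpa using h.eq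
  · simp [Function.update_of_ne hz]

theorem commute_siteOp_siteOp {x y : Λ} (hxy : x ≠ y) (A B : Matrix (Fin d) (Fin d) ℂ) :
    Commute (siteOp x A) (siteOp y B) :=
  commute_productOp_siteOp (by simp [Function.update_of_ne hxy.symm])

theorem siteOp_apply (y : Λ) (B : Matrix (Fin d) (Fin d) ℂ) (n n' : Λ → Fin d) :
    siteOp y B n n' = if ∀ z, z ≠ y → n z = n' z then B (n y) (n' y) else 0 := by
  simp only [siteOp, productOp, Matrix.of_apply]
  rw [Fintype.prod_eq_mul_prod_compl y, Function.update_self]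
  split_ifs with h
  · rw [Finset.prod_eq_one, mul_one]
    intro z hz
    have hz' : z ≠ y := by simpa using hz
    simp [Function.update_of_ne hz', h z hz']
  · push Not at h
    obtain ⟨z, hz, hne⟩ := h
    rw [Finset.prod_eq_zero (i := z) (by simpa using hz), mul_zero]
    simp [Function.update_of_ne hz, hne]

theorem siteOp_mul_apply (y : Λ) (B : Matrix (Fin d) (Fin d) ℂ) (O : Op Λ d)
    (n n' : Λ → Fin d) :
    (siteOp y B * O) n n' = ∑ a, B (n y) a * O (Function.update n y a) n' := by
  rw [Matrix.mul_apply]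
  symm
  refine Finset.sum_of_injOn (fun a => Function.update n y a) ?_ (by simp) ?_ ?_
  · intro a _ b _ h
    simpa using congrFun h y
  · intro m _ hm
    rw [siteOp_apply, if_neg, zero_mul]
    intro h
    apply hm
    refine ⟨m y, by simp, ?_⟩
    ext1 z
    by_cases hz : z = y
    · subst hz; simp
    · simp [Function.update_of_ne hz, h z hz]
  · intro a _
    rw [siteOp_apply, if_pos]
    · simp
    · intro z hz
      simp [Function.update_of_ne hz]

theorem mul_siteOp_apply (y : Λ) (B : Matrix (Fin d) (Fin d) ℂ) (O : Op Λ d)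
    (n n' : Λ → Fin d) :
    (O * siteOp y B) n n' = ∑ a, O n (Function.update n' y a) * B a (n' y) := by
  have h := siteOp_mul_apply y Bᵀ Oᵀ n' n
  have h2 : siteOp y Bᵀ = (siteOp y B)ᵀ := by
    ext m m'
    simp only [siteOp_apply, Matrix.transpose_apply, eq_comm]
  rw [h2, ← Matrix.transpose_mul, Matrix.transpose_apply] at h
  rw [h]
  exact Finset.sum_congr rfl fun a _ => mul_comm _ _

/-- An operator acts only on `X` if and only if it commutes with all one-site operators off `X`. -/
theorem supportedOn_iff_commute {X : Set Λ} {O : Op Λ d} :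
    SupportedOn X O ↔ ∀ y, y ∉ X → ∀ B, Commute O (siteOp y B) := by
  classical
  constructor
  · rintro ⟨A, rfl⟩ y hy B
    ext n n'
    rw [mul_siteOp_apply, siteOp_mul_apply]
    have e1 : ∀ (m : Λ → Fin d) (a : Fin d),
        (fun x : X => Function.update m y a x) = fun x : X => m x := by
      intro m a
      ext1 x
      have hxy : (x : Λ) ≠ y := fun h => hy (h ▸ x.2)
      exact Function.update_of_ne hxy _ _
    simp only [embed, Matrix.of_apply, e1]
    by_cases hc : ∀ z, z ∉ X → z ≠ y → n z = n' z
    · rw [Finset.sum_eq_single (n y), Finset.sum_eq_single (n' y), if_pos, if_pos, mul_comm]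
      · intro z hz
        by_cases h : z = y
        · subst h; simp
        · simpa [Function.update_of_ne h] using hc z hz h
      · intro z hz
        by_cases h : z = y
        · subst h; simp
        · simpa [Function.update_of_ne h] using hc z hz h
      · intro a _ ha
        rw [if_neg, mul_zero]
        intro h
        exact ha (by simpa using h y hy)
      · simp
      · intro a _ ha
        rw [if_neg, zero_mul]
        intro h
        exact ha (by simpa using (h y hy).symm)
      · simp
    · rw [Finset.sum_eq_zero, Finset.sum_eq_zero]
      · intro a _
        rw [if_neg, mul_zero]
        exact fun h => hc fun z hz hzy => by simpa [Function.update_of_ne hzy] using h z hz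
      · intro a _
        rw [if_neg, zero_mul]
        exact fun h => hc fun z hz hzy => by simpa [Function.update_of_ne hzy] using h z hz
  · intro h
    by_cases hne : Nonempty (Λ → Fin d)
    swap
    · exact ⟨0, by ext n; exact (hne ⟨n⟩).elim⟩
    obtain ⟨n₀⟩ := hne
    -- Commutation with the matrix unit `E_ab` at `y`. The choice `a = b = n' y` makes `O` diagonal
    -- in the label at `y`; the choice `a = n y` makes it insensitive to a common change of that
    -- label.
    have hmove : ∀ y, y ∉ X → ∀ (a b : Fin d) (n n' : Λ → Fin d),
        (if n y = a then O (Function.update n y b) n' else 0) =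
          if n' y = b then O n (Function.update n' y a) else 0 := by
      intro y hy a b n n'
      have := congrFun (congrFun (h y hy (Matrix.single a b 1)).eq n) n'
      rw [mul_siteOp_apply, siteOp_mul_apply] at this
      simpa [Matrix.single_apply, ite_and, eq_comm] using this.symm
    have hzero : ∀ y, y ∉ X → ∀ n n' : Λ → Fin d, n y ≠ n' y → O n n' = 0 := by
      intro y hy n n' hnn
      have := hmove y hy (n' y) (n' y) n n'
      simpa [hnn] using this.symm
    have hupd : ∀ y, y ∉ X → ∀ (n n' : Λ → Fin d) (b : Fin d), n y = n' y →
        O (Function.update n y b) (Function.update n' y b) = O n n' := by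
      intro y hy n n' b hnn
      have := hmove y hy (n y) b n (Function.update n' y b)
      simpa [hnn] using this
    have hall : ∀ (S : Finset Λ), (∀ y ∈ S, y ∉ X) → ∀ n n' : Λ → Fin d,
        (∀ y ∈ S, n y = n' y) → O (S.piecewise n₀ n) (S.piecewise n₀ n') = O n n' := by
      intro S
      induction S using Finset.induction_on with
      | empty => intros; simp
      | insert y S hyS ih =>
        intro hS n n' hnn
        rw [Finset.piecewise_insert, Finset.piecewise_insert, hupd y (hS y (by simp))]
        · exact ih (fun z hz => hS z (by simp [hz])) n n' fun z hz => hnn z (by simp [hz])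
        · simpa [hyS] using hnn y (by simp)
    -- The local matrix is read off from `O` with the reference configuration `n₀` filled in off
    -- `X`.
    refine ⟨Matrix.of fun m m' => O (fun x => if hx : x ∈ X then m ⟨x, hx⟩ else n₀ x)
      (fun x => if hx : x ∈ X then m' ⟨x, hx⟩ else n₀ x), ?_⟩
    ext n n'
    simp only [embed, Matrix.of_apply]
    split_ifs with hc
    · rw [← hall (Finset.univ.filter fun y => y ∉ X) (by simp) n n' (by simpa using hc)]
      congr 1 <;> ext x <;> by_cases hx : x ∈ X <;> simp [Finset.piecewise, hx]
    · push Not at hc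
      obtain ⟨y, hy, hne⟩ := hc
      exact hzero y hy n n' hne

end Tensor

end FerroScar

namespace FerroScar

open Function Finset Matrix

/-! ### Calculus of supports -/

section Support

variable {Λ : Type*} [Fintype Λ] [DecidableEq Λ] {d : ℕ}

theorem SupportedOn.mono {X Y : Set Λ} {O : Op Λ d} (h : SupportedOn X O) (hXY : X ⊆ Y) :
    SupportedOn Y O :=
  supportedOn_iff_commute.mpr fun y hy => supportedOn_iff_commute.mp h y fun hx => hy (hXY hx)

theorem SupportedOn.mul {X : Set Λ} {O O' : Op Λ d} (h : SupportedOn X O)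
    (h' : SupportedOn X O') : SupportedOn X (O * O') :=
  supportedOn_iff_commute.mpr fun y hy B =>
    (supportedOn_iff_commute.mp h y hy B).mul_left (supportedOn_iff_commute.mp h' y hy B)

theorem SupportedOn.add {X : Set Λ} {O O' : Op Λ d} (h : SupportedOn X O)
    (h' : SupportedOn X O') : SupportedOn X (O + O') :=
  supportedOn_iff_commute.mpr fun y hy B =>
    (supportedOn_iff_commute.mp h y hy B).add_left (supportedOn_iff_commute.mp h' y hy B)

theorem SupportedOn.sub {X : Set Λ} {O O' : Op Λ d} (h : SupportedOn X O)
    (h' : SupportedOn X O') : SupportedOn X (O - O') :=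
  supportedOn_iff_commute.mpr fun y hy B =>
    (supportedOn_iff_commute.mp h y hy B).sub_left (supportedOn_iff_commute.mp h' y hy B)

theorem SupportedOn.smul {X : Set Λ} {O : Op Λ d} (c : ℂ) (h : SupportedOn X O) :
    SupportedOn X (c • O) :=
  supportedOn_iff_commute.mpr fun y hy B => (supportedOn_iff_commute.mp h y hy B).smul_left c

theorem SupportedOn.sum {ι : Type*} {X : Set Λ} {s : Finset ι} {O : ι → Op Λ d}
    (h : ∀ i ∈ s, SupportedOn X (O i)) : SupportedOn X (∑ i ∈ s, O i) :=
  supportedOn_iff_commute.mpr fun y hy B =>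
    Commute.sum_left s O _ fun i hi => supportedOn_iff_commute.mp (h i hi) y hy B

theorem supportedOn_zero (X : Set Λ) : SupportedOn X (0 : Op Λ d) :=
  supportedOn_iff_commute.mpr fun _ _ _ => Commute.zero_left _

theorem supportedOn_one (X : Set Λ) : SupportedOn X (1 : Op Λ d) :=
  supportedOn_iff_commute.mpr fun _ _ _ => Commute.one_left _

theorem supportedOn_productOp {X : Set Λ} {A : Λ → Matrix (Fin d) (Fin d) ℂ}
    (hA : ∀ x, x ∉ X → A x = 1) : SupportedOn X (productOp A) :=
  supportedOn_iff_commute.mpr fun y hy B =>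
    commute_productOp_siteOp (by rw [hA y hy]; exact Commute.one_left B)

theorem supportedOn_siteOp (x : Λ) (A : Matrix (Fin d) (Fin d) ℂ) :
    SupportedOn {x} (siteOp x A) :=
  supportedOn_productOp fun _ hy => Function.update_of_ne hy _ _

theorem productOp_piecewise_insert (A : Λ → Matrix (Fin d) (Fin d) ℂ) {y : Λ} {S : Finset Λ}
    (hy : y ∉ S) :
    productOp ((insert y S).piecewise A fun _ => 1) =
      siteOp y (A y) * productOp (S.piecewise A fun _ => 1) := by
  rw [siteOp, productOp_mul, Finset.piecewise_insert]
  congr 1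
  ext1 z
  by_cases h : z = y
  · subst h; simp [hy]
  · simp [Function.update_of_ne h]

/-- A product operator trivial on `X` is a product of one-site operators off `X`, each of which
commutes with `O`. -/
theorem SupportedOn.commute_productOp {X : Set Λ} {O : Op Λ d} (h : SupportedOn X O)
    {A : Λ → Matrix (Fin d) (Fin d) ℂ} (hA : ∀ x ∈ X, A x = 1) : Commute O (productOp A) := by
  classical
  have key : ∀ S : Finset Λ, (∀ y ∈ S, y ∉ X) →
      Commute O (productOp (S.piecewise A fun _ => 1)) := by
    intro S
    induction S using Finset.induction_on with
    | empty =>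
      intro _
      rw [Finset.piecewise_empty, productOp_one]
      exact Commute.one_right O
    | insert y S hy ih =>
      intro hS
      rw [productOp_piecewise_insert A hy]
      exact (supportedOn_iff_commute.mp h y (hS y (by simp)) _).mul_right
        (ih fun z hz => hS z (by simp [hz]))
  have h1 := key (Finset.univ.filter fun y => y ∉ X) (by simp)
  convert h1 using 2
  ext1 z
  by_cases hz : z ∈ X
  · simp [Finset.piecewise, hz, hA z hz]
  · simp [Finset.piecewise, hz]

end Support

/-! ### Permutation operators and states symmetric on a region -/

section Permutation

variable {Λ : Type*} {d : ℕ}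

/-- The order reverses: `permute` is a right action. -/
theorem permute_permute (σ τ : Equiv.Perm Λ) (ψ : State Λ d) :
    permute σ (permute τ ψ) = permute (τ * σ) ψ := rfl

variable [Fintype Λ]

theorem permute_tensorVec (σ : Equiv.Perm Λ) (v : Λ → Fin d → ℂ) :
    permute σ (tensorVec v) = tensorVec (v ∘ σ) := by
  ext n
  simp only [permute, tensorVec, Function.comp]
  exact (Equiv.prod_comp σ _).symm.trans (by simp)

variable [DecidableEq Λ]

/-- The permutation operator as a matrix. -/
def permOp (Λ : Type*) [Fintype Λ] [DecidableEq Λ] (d : ℕ) (σ : Equiv.Perm Λ) : Op Λ d :=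
  Matrix.of fun n n' => if n ∘ σ.symm = n' then 1 else 0

theorem permOp_mulVec (σ : Equiv.Perm Λ) (ψ : State Λ d) :
    permOp Λ d σ *ᵥ ψ = permute σ ψ := by
  ext n
  simp [permOp, mulVec, dotProduct, permute]

theorem permOp_mul_apply (σ : Equiv.Perm Λ) (O : Op Λ d) (n n' : Λ → Fin d) :
    (permOp Λ d σ * O) n n' = O (n ∘ σ.symm) n' := by
  simp [permOp, Matrix.mul_apply]

theorem mul_permOp_apply (σ : Equiv.Perm Λ) (O : Op Λ d) (n n' : Λ → Fin d) :
    (O * permOp Λ d σ) n n' = O n (n' ∘ σ) := by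
  have h : ∀ m : Λ → Fin d, m ∘ σ.symm = n' ↔ m = n' ∘ σ := by
    intro m
    constructor
    · rintro rfl; ext1 x; simp
    · rintro rfl; ext1 x; simp
  simp [permOp, Matrix.mul_apply, h]

theorem commute_permOp_siteOp {σ : Equiv.Perm Λ} {z : Λ} (hz : σ z = z)
    (B : Matrix (Fin d) (Fin d) ℂ) : Commute (permOp Λ d σ) (siteOp z B) := by
  have hz' : σ.symm z = z := by rw [Equiv.symm_apply_eq, hz]
  ext n n'
  rw [permOp_mul_apply, mul_permOp_apply, siteOp_apply, siteOp_apply]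
  have hiff : (∀ w, w ≠ z → (n ∘ σ.symm) w = n' w) ↔ ∀ w, w ≠ z → n w = (n' ∘ σ) w := by
    constructor
    · intro h w hw
      have := h (σ w) (fun e => hw (σ.injective (e.trans hz.symm)))
      simpa using this
    · intro h w hw
      have := h (σ.symm w) (fun e => hw (σ.symm.injective (e.trans hz'.symm)))
      simpa using this
  rw [if_congr hiff rfl rfl]
  simp only [Function.comp, hz, hz']

/-- The projector onto the states that are odd under the exchange of `x` and `y`. -/
noncomputable def oddProj (d : ℕ) (x y : Λ) : Op Λ d :=
  (2⁻¹ : ℂ) • (1 - permOp Λ d (Equiv.swap x y))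

theorem isStarProjection_oddProj (x y : Λ) : IsStarProjection (oddProj d x y) := by
  have hsq : permOp Λ d (Equiv.swap x y) * permOp Λ d (Equiv.swap x y) = 1 := by
    ext n n'
    rw [permOp_mul_apply]
    simp only [permOp, Matrix.of_apply, Matrix.one_apply, Equiv.symm_swap]
    congr 2
    ext z
    simp
  have hst : (permOp Λ d (Equiv.swap x y))ᴴ = permOp Λ d (Equiv.swap x y) := by
    ext n n'
    simp only [permOp, Matrix.conjTranspose_apply, Matrix.of_apply]
    have : n' ∘ (Equiv.swap x y).symm = n ↔ n ∘ (Equiv.swap x y).symm = n' := by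
      constructor <;> (rintro rfl; ext z; simp)
    rw [if_congr this rfl rfl]
    split_ifs <;> simp
  constructor
  · rw [IsIdempotentElem, oddProj, smul_mul_smul_comm, sub_mul, mul_sub, mul_sub, hsq, one_mul,
      one_mul, mul_one]
    rw [show (1 - permOp Λ d (Equiv.swap x y) - (permOp Λ d (Equiv.swap x y) - 1) : Op Λ d)
      = (2 : ℂ) • (1 - permOp Λ d (Equiv.swap x y)) by rw [two_smul]; abel, smul_smul]
    norm_num
  · rw [IsSelfAdjoint, Matrix.star_eq_conjTranspose, oddProj, Matrix.conjTranspose_smul,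
      Matrix.conjTranspose_sub, hst, Matrix.conjTranspose_one]
    simp

theorem supportedOn_oddProj (x y : Λ) : SupportedOn {z | z ∈ s(x, y)} (oddProj d x y) := by
  refine ((supportedOn_one _).sub (supportedOn_iff_commute.mpr fun z hz B => ?_)).smul _
  simp only [Set.mem_ofPred_eq, Sym2.mem_iff, not_or] at hz
  exact commute_permOp_siteOp (Equiv.swap_apply_of_ne_of_ne hz.1 hz.2) B

theorem oddProj_mulVec_eq_zero_iff {x y : Λ} {ψ : State Λ d} :
    oddProj d x y *ᵥ ψ = 0 ↔ permute (Equiv.swap x y) ψ = ψ := by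
  rw [oddProj, Matrix.smul_mulVec, Matrix.sub_mulVec, Matrix.one_mulVec, permOp_mulVec,
    smul_eq_zero_iff_right (by norm_num), sub_eq_zero, eq_comm]

theorem oddProj_comm (x y : Λ) : oddProj d x y = oddProj d y x := by
  rw [oddProj, oddProj, Equiv.swap_comm]

/-- `oddProj` as a function of unordered pairs. -/
noncomputable def edgeProj (Λ : Type*) [Fintype Λ] [DecidableEq Λ] (d : ℕ) : Sym2 Λ → Op Λ d :=
  Sym2.lift ⟨oddProj d, oddProj_comm⟩

/-- The permutations that fix a state. -/
def fixingPerms (ψ : State Λ d) : Subgroup (Equiv.Perm Λ) where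
  carrier := {σ | permute σ ψ = ψ}
  one_mem' := rfl
  mul_mem' {σ τ} hσ hτ := by
    simp only [Set.mem_ofPred_eq] at *
    rw [← permute_permute, hσ, hτ]
  inv_mem' {σ} hσ := by
    simp only [Set.mem_ofPred_eq] at *
    rw [← hσ, permute_permute, mul_inv_cancel, hσ]
    rfl

/-- A state that is even under the exchange of neighbouring sites of a connected region is invariant
under all permutations of that region. -/
theorem permute_ofSubtype_of_preconnected {G : SimpleGraph Λ} {V : Finset Λ}
    (hV : (G.induce (V : Set Λ)).Preconnected) {ψ : State Λ d}
    (hψ : ∀ x ∈ V, ∀ y ∈ V, G.Adj x y → permute (Equiv.swap x y) ψ = ψ)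
    (σ : Equiv.Perm {x // x ∈ V}) : permute (Equiv.Perm.ofSubtype σ) ψ = ψ := by
  have hswap : ∀ a b : (V : Set Λ), Equiv.swap (a : Λ) (b : Λ) ∈ fixingPerms ψ := by
    intro a b
    -- Transpositions along the edges of a walk generate the transposition of its endpoints.
    obtain ⟨w⟩ := hV a b
    induction w with
    | nil => rw [Equiv.swap_self]; exact one_mem (fixingPerms ψ)
    | @cons u v w huv _ ih =>
      exact SubmonoidClass.swap_mem_trans _ (hψ u u.2 v v.2 huv) ih
  have htop : (fixingPerms ψ).comap (Equiv.Perm.ofSubtype (p := fun x => x ∈ V)) = ⊤ := by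
    rw [eq_top_iff, ← Equiv.Perm.closure_isSwap, Subgroup.closure_le]
    rintro _ ⟨a, b, _, rfl⟩
    rw [SetLike.mem_coe, Subgroup.mem_comap, Equiv.Perm.ofSubtype_swap_eq]
    exact hswap a b
  have : σ ∈ (fixingPerms ψ).comap (Equiv.Perm.ofSubtype (p := fun x => x ∈ V)) := by
    rw [htop]; trivial
  exact this

/-- An operator on the region `V` that annihilates the powers `v ⊗ ⋯ ⊗ v` with `v ∈ W` annihilates
all states that on `V` are `W`-valued and permutation invariant. -/
theorem mulVec_eq_zero_of_symmetric {V : Finset Λ} (hVne : V.Nonempty) {O : Op Λ d}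
    (hO : SupportedOn (V : Set Λ) O) {W : Submodule ℂ (Fin d → ℂ)}
    (hkill : ∀ v ∈ W, O *ᵥ tensorVec (fun _ => v) = 0)
    {P : Matrix (Fin d) (Fin d) ℂ} (hP : ∀ v, P *ᵥ v ∈ W) {φ : State Λ d}
    (hφP : ∀ x ∈ V, siteOp x P *ᵥ φ = φ)
    (hφS : ∀ σ : Equiv.Perm {x // x ∈ V}, permute (Equiv.Perm.ofSubtype σ) φ = φ) :
    O *ᵥ φ = 0 := by
  have hext : ∀ v ∈ W, ∀ w : Λ → Fin d → ℂ,
      O *ᵥ tensorVec (fun x => if x ∈ V then v else w x) = 0 := by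
    intro v hv w
    by_cases hv0 : v = 0
    · obtain ⟨x, hx⟩ := hVne
      have : tensorVec (fun x => if x ∈ V then v else w x) = 0 := by
        ext n
        exact Finset.prod_eq_zero (Finset.mem_univ x) (by simp [hx, hv0])
      rw [this, Matrix.mulVec_zero]
    · have hne : star v ⬝ᵥ v ≠ 0 := by
        open scoped ComplexOrder in exact fun h => hv0 (dotProduct_star_self_eq_zero.mp h)
      -- Off `V`, the factor `v` is turned into an arbitrary `w x` by a rank-one operator. These
      -- operators commute with `O`, so the hypothesis on `v^⊗N` transfers to states that equal `v`
      -- only on `V`.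
      have h1 : tensorVec (fun x => if x ∈ V then v else w x) =
          productOp (fun x => if x ∈ V then 1 else
            (star v ⬝ᵥ v)⁻¹ • Matrix.vecMulVec (w x) (star v)) *ᵥ tensorVec fun _ => v := by
        rw [productOp_mulVec]
        congr 1
        ext1 x
        split_ifs
        · simp
        · rw [Matrix.smul_mulVec, Matrix.vecMulVec_mulVec, op_smul_eq_smul,
            inv_smul_smul₀ hne]
      rw [h1, Matrix.mulVec_mulVec,
        (hO.commute_productOp (fun x hx => by simp [Finset.mem_coe.mp hx])).eq,
        ← Matrix.mulVec_mulVec, hkill v hv, Matrix.mulVec_zero]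
  have hpol : ∀ u : Λ → Fin d → ℂ, (∀ x ∈ V, u x ∈ W) →
      ∑ σ : Equiv.Perm {x // x ∈ V}, O *ᵥ tensorVec (u ∘ Equiv.Perm.ofSubtype σ) = 0 := by
    intro u hu
    have h2 := sum_perm_eq_zero_of_diagonal
      ((Matrix.mulVecLin O).compMultilinearMap
        ((tensorVecMultilinear Λ d).domDomRestrict (fun x => x ∈ V) fun x => u x)) W
      (fun v hv => hext v hv u) (fun x => u x) (fun x => hu x x.2)
    rw [← h2]
    refine Finset.sum_congr rfl fun σ _ => ?_
    change _ = O *ᵥ tensorVec _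
    congr 2
    ext1 x
    by_cases hx : x ∈ V
    · simp [hx, Equiv.Perm.ofSubtype_apply_of_mem σ hx]
    · simp [hx, Equiv.Perm.ofSubtype_apply_of_not_mem σ hx]
  have hPφ : ∀ S : Finset Λ, S ⊆ V → productOp (S.piecewise (fun _ => P) fun _ => 1) *ᵥ φ = φ := by
    intro S
    induction S using Finset.induction_on with
    | empty => intro _; rw [Finset.piecewise_empty, productOp_one, Matrix.one_mulVec]
    | insert y S hy ih =>
      intro hS
      rw [productOp_piecewise_insert _ hy, ← Matrix.mulVec_mulVec,
        ih ((Finset.subset_insert y S).trans hS), hφP y (hS (by simp))]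
  -- Expanding in the product basis after inserting `P` on `V` gives product states with all factors
  -- on `V` in `W`, to which `hpol` applies.
  have hexp : φ = ∑ m : Λ → Fin d, φ m • tensorVec
      (fun x => (V.piecewise (fun _ => P) fun _ => 1) x *ᵥ Pi.single (m x) 1) := by
    conv_lhs => rw [← hPφ V subset_rfl]
    have h3 : φ = ∑ m : Λ → Fin d, φ m • tensorVec (fun x => Pi.single (m x) (1 : ℂ)) := by
      ext n
      rw [Finset.sum_apply, Finset.sum_eq_single n]
      · simp [tensorVec]
      · intro m _ hm
        obtain ⟨x, hx⟩ := Function.ne_iff.mp hm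
        rw [Pi.smul_apply, tensorVec, Finset.prod_eq_zero (Finset.mem_univ x), smul_zero]
        exact Pi.single_eq_of_ne hx.symm _
      · simp
    conv_lhs => rw [h3]
    simp only [Matrix.mulVec_sum, Matrix.mulVec_smul, productOp_mulVec]
  have h4 : ∑ σ : Equiv.Perm {x // x ∈ V}, O *ᵥ permute (Equiv.Perm.ofSubtype σ) φ = 0 := by
    rw [hexp]
    simp only [← permOp_mulVec, Matrix.mulVec_sum, Matrix.mulVec_smul]
    rw [Finset.sum_comm]
    refine Finset.sum_eq_zero fun m _ => ?_
    rw [← Finset.smul_sum]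
    simp only [permOp_mulVec, permute_tensorVec]
    rw [hpol, smul_zero]
    intro x hx
    rw [Finset.piecewise_eq_of_mem _ _ _ hx]
    exact hP _
  simp only [hφS, Finset.sum_const, Finset.card_univ] at h4
  exact (smul_eq_zero_iff_right Fintype.card_ne_zero).mp h4

end Permutation

end FerroScar

namespace FerroScar

open Function Finset Matrix

namespace TargetSpace

/-! ### The target space on one site -/

section OneSite

variable {d r : ℕ} (T : TargetSpace d r)

/-- The coordinate vector of `|k⟩`. -/
def ketVec (k : Fin (r + 1)) : Fin d → ℂ := fun a => T.ket k a

/-- The coordinate vector of `⟨k|`. -/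
def braVec (k : Fin (r + 1)) : Fin d → ℂ := star (T.ketVec k)

/-- The target space in coordinates. -/
def vecSpace : Submodule ℂ (Fin d → ℂ) := Submodule.span ℂ (Set.range T.ketVec)

theorem braVec_dotProduct_ketVec (j k : Fin (r + 1)) :
    T.braVec j ⬝ᵥ T.ketVec k = if j = k then 1 else 0 := by
  have h := orthonormal_iff_ite.mp T.orthonormal j k
  rw [EuclideanSpace.inner_eq_star_dotProduct, dotProduct_comm] at h
  exact h

theorem dyad_eq_vecMulVec (k : Fin (r + 1)) :
    T.dyad k = vecMulVec (T.ketVec k) (T.braVec k) := rfl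

theorem dyad_mulVec (k : Fin (r + 1)) (v : Fin d → ℂ) :
    T.dyad k *ᵥ v = (T.braVec k ⬝ᵥ v) • T.ketVec k := by
  rw [dyad_eq_vecMulVec, vecMulVec_mulVec, op_smul_eq_smul]

theorem vecMul_dyad (k : Fin (r + 1)) (v : Fin d → ℂ) :
    v ᵥ* T.dyad k = (v ⬝ᵥ T.ketVec k) • T.braVec k := by
  rw [dyad_eq_vecMulVec, vecMul_vecMulVec]

theorem dyad_mul_dyad (j k : Fin (r + 1)) :
    T.dyad j * T.dyad k = if j = k then T.dyad k else 0 := by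
  rw [dyad_eq_vecMulVec, dyad_eq_vecMulVec, vecMulVec_mul_vecMulVec, braVec_dotProduct_ketVec]
  split_ifs with h <;> simp [h]

theorem dyad_conjTranspose (k : Fin (r + 1)) : (T.dyad k)ᴴ = T.dyad k := by
  ext a b
  simp [dyad, conjTranspose_apply, mul_comm]

theorem isStarProjection_proj : IsStarProjection T.proj := by
  constructor
  · simp [IsIdempotentElem, proj, Finset.sum_mul, Finset.mul_sum, dyad_mul_dyad]
  · rw [IsSelfAdjoint, star_eq_conjTranspose, proj, conjTranspose_sum]
    simp only [dyad_conjTranspose]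

theorem proj_mulVec (v : Fin d → ℂ) :
    T.proj *ᵥ v = ∑ k, (T.braVec k ⬝ᵥ v) • T.ketVec k := by
  simp only [proj, sum_mulVec, dyad_mulVec]

theorem proj_mulVec_mem (v : Fin d → ℂ) : T.proj *ᵥ v ∈ T.vecSpace := by
  rw [proj_mulVec]
  exact Submodule.sum_mem _ fun k _ =>
    Submodule.smul_mem _ _ (Submodule.subset_span (Set.mem_range_self k))

theorem proj_mulVec_ketVec (k : Fin (r + 1)) : T.proj *ᵥ T.ketVec k = T.ketVec k := by
  simp [proj_mulVec, braVec_dotProduct_ketVec]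

theorem braVec_vecMul_proj (k : Fin (r + 1)) : T.braVec k ᵥ* T.proj = T.braVec k := by
  simp [proj, vecMul_sum, vecMul_dyad, braVec_dotProduct_ketVec]

theorem mem_vecSpace_iff {v : Fin d → ℂ} :
    v ∈ T.vecSpace ↔ ∃ t : Fin (r + 1) → ℂ, v = ∑ k, t k • T.ketVec k := by
  rw [vecSpace, Submodule.mem_span_range_iff_exists_fun]
  simp only [eq_comm]

theorem proj_mulVec_of_mem {v : Fin d → ℂ} (hv : v ∈ T.vecSpace) : T.proj *ᵥ v = v := by
  obtain ⟨t, rfl⟩ := T.mem_vecSpace_iff.mp hv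
  simp only [mulVec_sum, mulVec_smul, proj_mulVec_ketVec]

theorem ofLp_mem_vecSpace {v : EuclideanSpace ℂ (Fin d)} (hv : v ∈ T.space) :
    (fun a => v a) ∈ T.vecSpace := by
  rw [space, Submodule.mem_span_range_iff_exists_fun] at hv
  obtain ⟨t, rfl⟩ := hv
  refine T.mem_vecSpace_iff.mpr ⟨t, ?_⟩
  ext a
  simp [ketVec]

theorem cartan_mulVec_ketVec (i : Fin r) (k : Fin (r + 1)) :
    T.cartan i *ᵥ T.ketVec k = (T.weight k i : ℂ) • T.ketVec k := by
  simp [cartan, sum_mulVec, smul_mulVec, dyad_mulVec, braVec_dotProduct_ketVec]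

theorem braVec_vecMul_cartan (i : Fin r) (k : Fin (r + 1)) :
    T.braVec k ᵥ* T.cartan i = (T.weight k i : ℂ) • T.braVec k := by
  simp [cartan, vecMul_sum, vecMul_smul, vecMul_dyad, braVec_dotProduct_ketVec]

/-- Every function on the on-site weights is affine linear in the weights. -/
theorem exists_affine (g : Fin (r + 1) → ℂ) :
    ∃ (b : Fin r → ℂ) (c : ℂ), ∀ k, g k = ∑ i, b i * (T.weight k i : ℂ) + c := by
  have hreal : ∀ g : Fin (r + 1) → ℝ, ∃ (b : Fin r → ℝ) (c : ℝ),
      ∀ k, g k = ∑ i, b i * T.weight k i + c := by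
    intro g
    -- The weight functions sum to zero over the labels, the constant function does not; so the
    -- constant joins them to a basis of the real functions on the `r + 1` labels. Complex functions
    -- are split into real and imaginary parts.
    have hli : LinearIndependent ℝ
        (Fin.cons (fun _ => 1) (fun (i : Fin r) (k : Fin (r + 1)) => T.weight k i) :
          Fin (r + 1) → Fin (r + 1) → ℝ) := by
      rw [linearIndependent_finCons]
      refine ⟨T.weight_indep, fun hmem => ?_⟩
      obtain ⟨t, ht⟩ := (Submodule.mem_span_range_iff_exists_fun ℝ).mp hmem
      have h1 : ∑ k : Fin (r + 1), (∑ i, t i • (fun k => T.weight k i)) k = 0 := by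
        simp only [Finset.sum_apply, Pi.smul_apply, smul_eq_mul]
        rw [Finset.sum_comm]
        simp [← Finset.mul_sum, T.weight_sum]
      rw [ht] at h1
      simp at h1
      norm_cast at h1
    have htop := hli.span_eq_top_of_card_eq_finrank' (by simp)
    have hg : g ∈ Submodule.span ℝ (Set.range
        (Fin.cons (fun _ => 1) (fun (i : Fin r) (k : Fin (r + 1)) => T.weight k i) :
          Fin (r + 1) → Fin (r + 1) → ℝ)) := by
      rw [htop]; trivial
    obtain ⟨t, ht⟩ := (Submodule.mem_span_range_iff_exists_fun ℝ).mp hg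
    refine ⟨fun i => t i.succ, t 0, fun k => ?_⟩
    rw [← ht, Fin.sum_univ_succ]
    simp [add_comm]
  obtain ⟨b, c, h⟩ := hreal fun k => (g k).re
  obtain ⟨b', c', h'⟩ := hreal fun k => (g k).im
  refine ⟨fun i => b i + b' i * Complex.I, c + c' * Complex.I, fun k => ?_⟩
  rw [← Complex.re_add_im (g k), h k, h' k]
  push_cast
  simp only [add_mul, Finset.sum_add_distrib, Finset.sum_mul]
  have : ∀ i, (b' i : ℂ) * (T.weight k i : ℂ) * Complex.I
      = b' i * Complex.I * (T.weight k i : ℂ) := fun i => by ring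
  simp only [this]
  ring

end OneSite

/-! ### Annihilating projectors and weight states -/

section ManySites

variable {d r : ℕ} (T : TargetSpace d r) {Λ : Type*} [Fintype Λ] [DecidableEq Λ]

/-- The projector onto the states that leave the target space at site `x`. -/
def leakProj (x : Λ) : Op Λ d := siteOp x (1 - T.proj)

theorem isStarProjection_leakProj (x : Λ) : IsStarProjection (T.leakProj x) := by
  have h := T.isStarProjection_proj.one_sub
  constructor
  · rw [IsIdempotentElem, leakProj, siteOp_mul, h.isIdempotentElem.eq]
  · rw [IsSelfAdjoint, star_eq_conjTranspose, leakProj, siteOp_conjTranspose]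
    exact congrArg _ h.isSelfAdjoint

theorem leakProj_mulVec_tensorVec {v : Λ → Fin d → ℂ} {x : Λ} (hv : v x ∈ T.vecSpace) :
    T.leakProj x *ᵥ tensorVec v = 0 := by
  rw [leakProj, siteOp_mulVec, sub_mulVec, one_mulVec, T.proj_mulVec_of_mem hv, sub_self]
  exact (tensorVecMultilinear Λ d).map_update_zero v x

theorem isLocalAnnihilatingProjector_leakProj (x : Λ) :
    T.IsLocalAnnihilatingProjector {x} (T.leakProj x) := by
  refine ⟨T.isStarProjection_leakProj x, supportedOn_siteOp x _, fun ψ hψ => ?_⟩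
  obtain ⟨hspan, -⟩ := hψ
  induction hspan using Submodule.span_induction with
  | mem φ hφ =>
    obtain ⟨v, hv, rfl⟩ := hφ
    exact T.leakProj_mulVec_tensorVec (v := fun x a => v x a) (T.ofLp_mem_vecSpace (hv x))
  | zero => exact mulVec_zero _
  | add φ χ _ _ h1 h2 => rw [mulVec_add, h1, h2, add_zero]
  | smul c φ _ h1 => rw [mulVec_smul, h1, smul_zero]

theorem isLocalAnnihilatingProjector_edgeProj (e : Sym2 Λ) :
    T.IsLocalAnnihilatingProjector {z | z ∈ e} (edgeProj Λ d e) := by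
  induction e using Sym2.ind with
  | _ x y =>
    exact ⟨isStarProjection_oddProj x y, supportedOn_oddProj x y,
      fun ψ hψ => oddProj_mulVec_eq_zero_iff.mpr (hψ.2 _)⟩

theorem weightState_eq (k : Λ → Fin (r + 1)) :
    T.weightState k = ∑ σ : Equiv.Perm Λ, tensorVec fun x => T.ketVec (k (σ x)) := by
  refine Finset.sum_congr rfl fun σ _ => ?_
  exact permute_tensorVec σ fun x => T.ketVec (k x)

theorem weightState_mem_symSpace (k : Λ → Fin (r + 1)) : T.weightState k ∈ T.symSpace Λ := by
  constructor
  · rw [weightState_eq]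
    refine Submodule.sum_mem _ fun σ _ => Submodule.subset_span
      ⟨fun x => T.ket (k (σ x)), fun x => Submodule.subset_span (Set.mem_range_self _), rfl⟩
  · intro τ
    rw [← permOp_mulVec, weightState_eq, mulVec_sum]
    simp only [permOp_mulVec, permute_tensorVec]
    exact Fintype.sum_equiv (Equiv.mulRight τ) _ _ fun σ => rfl

end ManySites

end TargetSpace

/-! ### Operators in the span of the local annihilating projectors -/

section Decomposition

variable {d r : ℕ} (T : TargetSpace d r) {Λ : Type*} [Fintype Λ] [DecidableEq Λ]

/-- `O` is a sum of local multiples of the projectors `leakProj` and `edgeProj`, with coefficients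
supported as the interaction `h` prescribes. -/
def Decomposes (T : TargetSpace d r) (G : SimpleGraph Λ) [DecidableRel G.Adj]
    (h : Finset Λ → Op Λ d) (O : Op Λ d) : Prop :=
  ∃ (h₁ : Λ → Op Λ d) (h₂ : Sym2 Λ → Op Λ d),
    O = ∑ x, h₁ x * T.leakProj x + ∑ e ∈ G.edgeFinset, h₂ e * edgeProj Λ d e ∧
    (∀ x, SupportedOn (interactionHull h x) (h₁ x)) ∧
    ∀ e ∈ G.edgeFinset, SupportedOn {z | ∀ x ∈ e, z ∈ interactionHull h x} (h₂ e)

variable {T} {G : SimpleGraph Λ} [DecidableRel G.Adj] {h : Finset Λ → Op Λ d}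

theorem Decomposes.zero : Decomposes T G h 0 :=
  ⟨0, 0, by simp, fun _ => supportedOn_zero _, fun _ _ => supportedOn_zero _⟩

theorem Decomposes.add {O O' : Op Λ d} (hO : Decomposes T G h O) (hO' : Decomposes T G h O') :
    Decomposes T G h (O + O') := by
  obtain ⟨a, b, rfl, ha, hb⟩ := hO
  obtain ⟨a', b', rfl, ha', hb'⟩ := hO'
  refine ⟨a + a', b + b', ?_, fun x => (ha x).add (ha' x), fun e he => (hb e he).add (hb' e he)⟩
  simp only [Pi.add_apply, add_mul, Finset.sum_add_distrib]
  abel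

theorem Decomposes.sum {ι : Type*} {s : Finset ι} {O : ι → Op Λ d}
    (hO : ∀ i ∈ s, Decomposes T G h (O i)) : Decomposes T G h (∑ i ∈ s, O i) :=
  Finset.sum_induction O _ (fun _ _ => Decomposes.add) Decomposes.zero hO

theorem Decomposes.smul_leakProj (c : ℂ) (x : Λ) : Decomposes T G h (c • T.leakProj x) := by
  refine ⟨Pi.single x (c • 1), 0, ?_, fun y => ?_, fun _ _ => supportedOn_zero _⟩
  · rw [Finset.sum_eq_single x (fun y _ hy => by simp [hy]) (by simp)]
    simp
  · by_cases hy : y = x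
    · subst hy
      rw [Pi.single_eq_same]
      exact (supportedOn_one _).smul c
    · rw [Pi.single_eq_of_ne hy]
      exact supportedOn_zero _

/-- An operator on a connected region that annihilates the symmetric product states is a combination
of the local annihilating projectors. -/
theorem decomposes_of_annihilates {V : Finset Λ} (hne : V.Nonempty)
    (hconn : (G.induce (V : Set Λ)).Preconnected)
    (hhull : ∀ x ∈ V, (V : Set Λ) ⊆ interactionHull h x) {O : Op Λ d}
    (hO : SupportedOn (V : Set Λ) O)
    (hkill : ∀ v ∈ T.vecSpace, O *ᵥ tensorVec (fun _ => v) = 0) : Decomposes T G h O := by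
  classical
  set s₂ : Finset (Sym2 Λ) := G.edgeFinset.filter fun e => ∀ x ∈ e, x ∈ V with hs₂
  obtain ⟨R, hR, hRC⟩ := exists_eq_sum_mul_of_common_kernel (V.disjSum s₂)
    (Sum.elim T.leakProj (edgeProj Λ d))
    (by
      rintro (x | e) _
      · exact T.isStarProjection_leakProj x
      · exact (T.isLocalAnnihilatingProjector_edgeProj e).1) O
    (by
      intro φ hφ
      have h1 : ∀ x ∈ V, T.leakProj x *ᵥ φ = 0 := fun x hx =>
        hφ (Sum.inl x) (Finset.inl_mem_disjSum.mpr hx)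
      have h2 : ∀ e ∈ s₂, edgeProj Λ d e *ᵥ φ = 0 := fun e he =>
        hφ (Sum.inr e) (Finset.inr_mem_disjSum.mpr he)
      refine mulVec_eq_zero_of_symmetric hne hO hkill T.proj_mulVec_mem (fun x hx => ?_)
        (permute_ofSubtype_of_preconnected hconn fun x hx y hy hxy => ?_)
      · have := h1 x hx
        rw [TargetSpace.leakProj, siteOp_sub, siteOp_one, sub_mulVec, one_mulVec, sub_eq_zero]
          at this
        exact this.symm
      · refine oddProj_mulVec_eq_zero_iff.mp (h2 s(x, y) ?_)
        simp [hs₂, hxy, hx, hy])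
  -- All chosen projectors commute with one-site operators off `V`, and `R` inherits this.
  have hsupp : SupportedOn (V : Set Λ) (O * R) := by
    refine hO.mul (supportedOn_iff_commute.mpr fun y hy B => hRC _ ?_)
    rintro (x | e) hi
    · have hx : x ∈ V := Finset.inl_mem_disjSum.mp hi
      have hxy : x ≠ y := by rintro rfl; exact hy hx
      exact commute_siteOp_siteOp hxy _ _
    · have he : e ∈ s₂ := Finset.inr_mem_disjSum.mp hi
      refine supportedOn_iff_commute.mp (T.isLocalAnnihilatingProjector_edgeProj e).2.1 y ?_ B
      exact fun hye => hy ((Finset.mem_filter.mp he).2 y hye)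
  refine ⟨fun x => if x ∈ V then O * R else 0, fun e => if ∀ x ∈ e, x ∈ V then O * R else 0,
    ?_, fun x => ?_, fun e _ => ?_⟩
  · conv_lhs => rw [hR, Finset.sum_disjSum]
    simp only [Sum.elim_inl, Sum.elim_inr, ite_mul, zero_mul, hs₂, Finset.sum_filter,
      Finset.sum_ite_mem, Finset.univ_inter]
  · dsimp only
    split_ifs with hx
    · exact hsupp.mono (hhull x hx)
    · exact supportedOn_zero _
  · dsimp only
    split_ifs with he
    · exact hsupp.mono fun z hz x hx => hhull x (he x hx) hz
    · exact supportedOn_zero _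

end Decomposition

end FerroScar

namespace FerroScar

open Function Finset Matrix

namespace TargetSpace

variable {d r : ℕ} (T : TargetSpace d r) {Λ : Type*} [Fintype Λ] [DecidableEq Λ]

/-! ### Configurations, symmetric product states and target projections -/

section Configurations

/-- The product state `⨂_x |n_x⟩`. -/
def ketConf (n : Λ → Fin (r + 1)) : State Λ d := tensorVec fun x => T.ketVec (n x)

/-- The coordinate vector of the functional `⨂_x ⟨n_x|`. -/
def braConf (n : Λ → Fin (r + 1)) : State Λ d := tensorVec fun x => T.braVec (n x)

theorem tensorVec_sum_smul_ketVec (t : Fin (r + 1) → ℂ) :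
    tensorVec (fun _ : Λ => ∑ k, t k • T.ketVec k) =
      ∑ n : Λ → Fin (r + 1), (∏ x, t (n x)) • T.ketConf n := by
  refine ((tensorVecMultilinear Λ d).map_sum fun _ k => t k • T.ketVec k).trans ?_
  exact Finset.sum_congr rfl fun n _ =>
    (tensorVecMultilinear Λ d).map_smul_univ (fun x => t (n x)) fun x => T.ketVec (n x)

/-- The coefficients `∏ x, t (n x)` are permutation invariant, so each of the `N!` permutations in
the weight states reproduces the full expansion of the product state. -/
theorem card_smul_tensorVec (t : Fin (r + 1) → ℂ) :
    (Fintype.card (Equiv.Perm Λ) : ℂ) • tensorVec (fun _ : Λ => ∑ k, t k • T.ketVec k) =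
      ∑ n : Λ → Fin (r + 1), (∏ x, t (n x)) • T.weightState n := by
  have hσ : ∀ σ : Equiv.Perm Λ,
      ∑ n : Λ → Fin (r + 1), (∏ x, t (n x)) • tensorVec (fun x => T.ketVec (n (σ x))) =
        ∑ n : Λ → Fin (r + 1), (∏ x, t (n x)) • T.ketConf n := by
    intro σ
    refine Fintype.sum_equiv (Equiv.arrowCongr σ.symm (Equiv.refl _)) _ _ fun n => ?_
    rw [← Equiv.prod_comp σ fun x => t (n x)]
    rfl
  simp only [weightState_eq, Finset.smul_sum]
  rw [Finset.sum_comm]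
  simp only [hσ]
  rw [tensorVec_sum_smul_ketVec, Finset.sum_const, Finset.card_univ, ← Nat.cast_smul_eq_nsmul ℂ]

theorem leakProj_mulVec_weightState (y : Λ) (k : Λ → Fin (r + 1)) :
    T.leakProj y *ᵥ T.weightState k = 0 :=
  (T.isLocalAnnihilatingProjector_leakProj y).2.2 _ (T.weightState_mem_symSpace k)

theorem exists_mulVec_tensorVec {H : Op Λ d}
    (heig : ∀ k : Λ → Fin (r + 1), ∃ E : ℂ, H *ᵥ T.weightState k = E • T.weightState k)
    (t : Fin (r + 1) → ℂ) : ∃ a : (Λ → Fin (r + 1)) → ℂ,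
      H *ᵥ tensorVec (fun _ : Λ => ∑ k, t k • T.ketVec k) = ∑ n, a n • T.weightState n := by
  choose E hE using heig
  have hcard : (Fintype.card (Equiv.Perm Λ) : ℂ) ≠ 0 := by
    exact_mod_cast Fintype.card_ne_zero
  refine ⟨fun n => (Fintype.card (Equiv.Perm Λ) : ℂ)⁻¹ * ((∏ x, t (n x)) * E n), ?_⟩
  rw [← inv_smul_smul₀ hcard (tensorVec _), card_smul_tensorVec]
  simp only [mulVec_smul, mulVec_sum, hE, Finset.smul_sum, smul_smul, mul_assoc]

/-- `v^⊗N` is a combination of weight states, on which `H` is diagonal, and weight states do not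
leak. -/
theorem leakProj_mulVec_mulVec {H : Op Λ d}
    (heig : ∀ k : Λ → Fin (r + 1), ∃ E : ℂ, H *ᵥ T.weightState k = E • T.weightState k)
    {v : Fin d → ℂ} (hv : v ∈ T.vecSpace) (y : Λ) :
    T.leakProj y *ᵥ (H *ᵥ tensorVec (fun _ => v)) = 0 := by
  obtain ⟨t, rfl⟩ := T.mem_vecSpace_iff.mp hv
  obtain ⟨a, ha⟩ := T.exists_mulVec_tensorVec heig t
  rw [ha, mulVec_sum]
  exact Finset.sum_eq_zero fun n _ => by
    rw [mulVec_smul, leakProj_mulVec_weightState, smul_zero]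

theorem projOn_mul_projOn (S S' : Finset Λ) :
    (T.projOn S * T.projOn S' : Op Λ d) = T.projOn (S ∪ S') := by
  rw [projOn, projOn, projOn, productOp_mul]
  congr 1
  ext1 x
  by_cases h : x ∈ S <;> by_cases h' : x ∈ S' <;>
    simp [h, h', T.isStarProjection_proj.isIdempotentElem.eq]

theorem projOn_mulVec_tensorVec (S : Finset Λ) {v : Λ → Fin d → ℂ}
    (hv : ∀ x ∈ S, v x ∈ T.vecSpace) : T.projOn S *ᵥ tensorVec v = tensorVec v := by
  rw [projOn, productOp_mulVec]
  congr 1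
  ext1 x
  split_ifs with hx
  · exact T.proj_mulVec_of_mem (hv x hx)
  · exact one_mulVec _

theorem braConf_vecMul_projOn (S : Finset Λ) (n : Λ → Fin (r + 1)) :
    T.braConf n ᵥ* T.projOn S = T.braConf n := by
  rw [projOn, braConf, vecMul_productOp]
  congr 1
  ext1 x
  split_ifs with hx
  · exact T.braVec_vecMul_proj _
  · exact vecMul_one _

theorem supportedOn_projOn (S : Finset Λ) : SupportedOn (S : Set Λ) (T.projOn S : Op Λ d) :=
  supportedOn_productOp fun _ hx => if_neg hx

theorem commute_projOn {X : Set Λ} {O : Op Λ d} (hO : SupportedOn X O) {S : Finset Λ}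
    (hS : ∀ x ∈ X, x ∉ S) : Commute O (T.projOn S) :=
  hO.commute_productOp fun x hx => if_neg (hS x hx)

theorem projOn_empty : T.projOn (∅ : Finset Λ) = (1 : Op Λ d) := by
  simp [projOn, productOp_one]

theorem projOn_insert {y : Λ} {S : Finset Λ} (hy : y ∉ S) :
    T.projOn (insert y S) = siteOp y T.proj * T.projOn S :=
  productOp_piecewise_insert (fun _ => T.proj) hy

theorem projOn_univ_eq_sum :
    (T.projOn Finset.univ : Op Λ d) = ∑ n, vecMulVec (T.ketConf n) (T.braConf n) := by
  have h := (productOpMultilinear Λ d).map_sum fun _ k => T.dyad k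
  simp only [projOn, Finset.mem_univ, if_true]
  refine h.trans (Finset.sum_congr rfl fun n _ => ?_)
  ext m m'
  exact Finset.prod_mul_distrib

theorem eq_sum_of_projOn_univ {ψ : State Λ d} (hψ : T.projOn Finset.univ *ᵥ ψ = ψ) :
    ψ = ∑ n, (T.braConf n ⬝ᵥ ψ) • T.ketConf n := by
  conv_lhs => rw [← hψ, projOn_univ_eq_sum, sum_mulVec]
  simp only [vecMulVec_mulVec, op_smul_eq_smul]

end Configurations

/-! ### Removal of leakage out of the target space, site by site -/

section Leakage

variable {T} {G : SimpleGraph Λ} [DecidableRel G.Adj] {h : Finset Λ → Op Λ d}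

/-- Up to local annihilating terms, the output of every interaction term can be projected onto the
target space. -/
theorem decomposes_sub_sum_projOn_mul (hloc : IsLocal G h)
    (heig : ∀ k : Λ → Fin (r + 1), ∃ E : ℂ,
      (∑ X, h X) *ᵥ T.weightState k = E • T.weightState k) (S : Finset Λ) :
    Decomposes T G h (∑ X, h X - ∑ X, T.projOn (X ∩ S) * h X) := by
  classical
  induction S using Finset.induction_on with
  | empty =>
    simp only [Finset.inter_empty, projOn_empty, one_mul, sub_self]
    exact Decomposes.zero
  | insert y S hy ih =>
    set s := Finset.univ.filter fun X => h X ≠ 0 ∧ y ∈ X with hs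
    set A := ∑ X ∈ s, T.leakProj y * (T.projOn (X ∩ S) * h X) with hA
    have hstep : ∑ X, T.projOn (X ∩ S) * h X - ∑ X, T.projOn (X ∩ insert y S) * h X = A := by
      rw [← Finset.sum_sub_distrib, hA, hs, Finset.sum_filter]
      refine Finset.sum_congr rfl fun X _ => ?_
      split_ifs with hX
      · rw [Finset.inter_insert_of_mem hX.2, T.projOn_insert (by simp [hy]), leakProj, siteOp_sub,
          siteOp_one, sub_mul, one_mul, mul_assoc]
      · by_cases h0 : h X = 0
        · simp [h0]
        · rw [Finset.inter_insert_of_notMem fun hyX => hX ⟨h0, hyX⟩, sub_self]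
    have hsplit : ∑ X, h X - ∑ X, T.projOn (X ∩ insert y S) * h X =
        (∑ X, h X - ∑ X, T.projOn (X ∩ S) * h X) + A := by
      rw [← hstep]; abel
    rw [hsplit]
    refine ih.add ?_
    by_cases hse : s = ∅
    · rw [hA, hse, Finset.sum_empty]
      exact Decomposes.zero
    have hmem : ∀ X ∈ s, h X ≠ 0 ∧ y ∈ X := fun X hX => (Finset.mem_filter.mp hX).2
    obtain ⟨X₀, hX₀⟩ := Finset.nonempty_iff_ne_empty.mpr hse
    have hsub : ∀ X ∈ s, (X : Set Λ) ⊆ (s.biUnion id : Finset Λ) := fun X hX z hz =>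
      Finset.mem_coe.mpr (Finset.mem_biUnion.mpr ⟨X, hX, hz⟩)
    -- All regions in `s` share `y`: their union is connected, and any two of them meet, so the
    -- union lies in the hull of each of its points.
    refine decomposes_of_annihilates (V := s.biUnion id)
      ⟨y, Finset.mem_biUnion.mpr ⟨X₀, hX₀, (hmem X₀ hX₀).2⟩⟩ ?_ ?_ ?_ ?_
    · have hV : ((s.biUnion id : Finset Λ) : Set Λ) =
        ⋃₀ Set.image (fun X : Finset Λ => (X : Set Λ)) s := by
        ext z; simp
      rw [hV]
      refine (SimpleGraph.induce_sUnion_connected_of_pairwise_not_disjoint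
        ⟨_, Set.mem_image_of_mem _ hX₀⟩ ?_ ?_).preconnected
      · rintro _ _ ⟨X, hX, rfl⟩ ⟨Y, hY, rfl⟩
        exact ⟨y, (hmem X hX).2, (hmem Y hY).2⟩
      · rintro _ ⟨X, hX, rfl⟩
        exact hloc.connected X (hmem X hX).1
    · intro x hx z hz
      obtain ⟨X, hX, hxX⟩ := Finset.mem_biUnion.mp hx
      obtain ⟨Y, hY, hzY⟩ := Finset.mem_biUnion.mp (Finset.mem_coe.mp hz)
      exact ⟨X, Y, (hmem X hX).1, (hmem Y hY).1, hxX, hzY, y, (hmem X hX).2, (hmem Y hY).2⟩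
    · refine SupportedOn.sum fun X hX => SupportedOn.mul ?_ (SupportedOn.mul ?_ ?_)
      · exact (supportedOn_siteOp y _).mono
          (Set.singleton_subset_iff.mpr (hsub X hX (hmem X hX).2))
      · refine (T.supportedOn_projOn _).mono (Set.Subset.trans ?_ (hsub X hX))
        exact Finset.coe_subset.mpr Finset.inter_subset_left
      · exact (hloc.supported X).mono (hsub X hX)
    · intro v hv
      have hcomm : Commute (T.projOn S : Op Λ d) (T.leakProj y) :=
        commute_productOp_siteOp (by simp [hy])
      -- The leakage of the full `H` at `y` vanishes, also after projecting on `S`. In the terms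
      -- containing `y`, the part of the projection outside `X` passes to the right and is absorbed
      -- by the state; in the other terms the leakage projector itself does so and gives zero.
      have hzero : (T.projOn S * T.leakProj y) *ᵥ ((∑ X, h X) *ᵥ tensorVec fun _ => v) = 0 := by
        rw [← mulVec_mulVec, T.leakProj_mulVec_mulVec heig hv, mulVec_zero]
      rw [← hzero, hcomm.eq, hA, sum_mulVec, sum_mulVec, mulVec_sum, hs, Finset.sum_filter]
      refine Finset.sum_congr rfl fun X _ => ?_
      split_ifs with hX
      · have h1 : T.projOn S = T.projOn (X ∩ S) * (T.projOn (S \ X) : Op Λ d) := by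
          rw [projOn_mul_projOn]
          congr 1
          ext z
          simp only [Finset.mem_union, Finset.mem_inter, Finset.mem_sdiff]
          tauto
        have h2 := T.commute_projOn (hloc.supported X) (S := S \ X)
          (fun x hx => by simp [Finset.mem_coe.mp hx])
        rw [mulVec_mulVec, h1, mul_assoc, mul_assoc, ← h2.eq, ← mul_assoc, ← mul_assoc,
          ← mul_assoc, ← mulVec_mulVec _ _ (T.projOn (S \ X)),
          projOn_mulVec_tensorVec _ _ fun _ _ => hv]
      · by_cases h0 : h X = 0
        · simp [h0]
        · have h3 := supportedOn_iff_commute.mp (hloc.supported X) y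
            (fun hyX => hX ⟨h0, hyX⟩) (1 - T.proj)
          rw [← hcomm.eq, mulVec_mulVec, mul_assoc, leakProj, ← h3.eq, ← mul_assoc,
            ← mulVec_mulVec, ← leakProj, leakProj_mulVec_tensorVec _ hv, mulVec_zero]

end Leakage

end TargetSpace

end FerroScar

namespace FerroScar

open Function Finset Matrix

/-! ### Symmetric functions of configurations without correlations -/

section Additive

variable {Λ κ : Type*} [DecidableEq Λ]

theorem exists_perm_of_ne {x y x₀ y₀ : Λ} (hxy : x ≠ y) (h₀ : x₀ ≠ y₀) :
    ∃ τ : Equiv.Perm Λ, τ x = x₀ ∧ τ y = y₀ := by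
  have hy' : Equiv.swap x x₀ y ≠ x₀ := by
    rw [Ne, Equiv.swap_apply_eq_iff, Equiv.swap_apply_right]; exact hxy.symm
  refine ⟨Equiv.swap (Equiv.swap x x₀ y) y₀ * Equiv.swap x x₀, ?_, ?_⟩
  · rw [Equiv.Perm.mul_apply, Equiv.swap_apply_left]
    exact Equiv.swap_apply_of_ne_of_ne hy'.symm h₀
  · rw [Equiv.Perm.mul_apply, Equiv.swap_apply_left]

/-- A permutation-invariant function of configurations without two-site correlations is a sum of
identical one-site contributions. -/
theorem exists_eq_sum_of_symmetric [Fintype Λ] [Nonempty Λ] [Nonempty κ] (F : (Λ → κ) → ℂ)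
    (hsymm : ∀ (n : Λ → κ) (σ : Equiv.Perm Λ), F (n ∘ σ) = F n)
    (hmixed : ∀ x y, x ≠ y → ∀ (n : Λ → κ) (a b : κ),
      F (update (update n x a) y b) + F n = F (update n x a) + F (update n y b)) :
    ∃ ε : κ → ℂ, ∀ n, F n = ∑ x, ε (n x) := by
  obtain ⟨x₀⟩ := ‹Nonempty Λ›
  obtain ⟨a₀⟩ := ‹Nonempty κ›
  set n₀ : Λ → κ := fun _ => a₀ with hn₀
  -- Changing site `y` has the same effect on every background, by altering the background one site
  -- at a time.
  have hone : ∀ (n : Λ → κ) (y : Λ) (b : κ) (S : Finset Λ), y ∉ S →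
      F (update (S.piecewise n n₀) y b) + F n₀ = F (S.piecewise n n₀) + F (update n₀ y b) := by
    intro n y b S
    induction S using Finset.induction_on with
    | empty => intro _; rw [Finset.piecewise_empty, add_comm]
    | insert x S hx ih =>
      intro hy
      rw [Finset.mem_insert, not_or] at hy
      have h1 := hmixed x y (Ne.symm hy.1) (S.piecewise n n₀) (n x) b
      have h2 := ih hy.2
      rw [Finset.piecewise_insert]
      linear_combination h1 + h2
  have hadd : ∀ (n : Λ → κ) (S : Finset Λ),
      F (S.piecewise n n₀) = F n₀ + ∑ x ∈ S, (F (update n₀ x (n x)) - F n₀) := by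
    intro n S
    induction S using Finset.induction_on with
    | empty => simp
    | insert y S hy ih =>
      rw [Finset.piecewise_insert, Finset.sum_insert hy]
      linear_combination hone n y (n y) S hy + ih
  have hsite : ∀ x a, F (update n₀ x a) = F (update n₀ x₀ a) := by
    intro x a
    rw [← hsymm (update n₀ x₀ a) (Equiv.swap x x₀)]
    congr 1
    ext z
    by_cases hz : z = x
    · subst hz; simp
    · have : Equiv.swap x x₀ z ≠ x₀ := by
        rw [Ne, Equiv.swap_apply_eq_iff, Equiv.swap_apply_right]; exact hz
      simp [Function.update_of_ne hz, Function.update_of_ne this, hn₀]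
  have hcard : (Fintype.card Λ : ℂ) ≠ 0 := by
    have : Nonempty Λ := ⟨x₀⟩
    exact_mod_cast Fintype.card_ne_zero
  -- The constant `F n₀` is shared equally among the sites, so that no separate additive term
  -- remains.
  refine ⟨fun a => F (update n₀ x₀ a) - F n₀ + (Fintype.card Λ : ℂ)⁻¹ * F n₀, fun n => ?_⟩
  have h := hadd n Finset.univ
  rw [Finset.piecewise_univ] at h
  rw [h, Finset.sum_add_distrib, Finset.sum_const, Finset.card_univ, nsmul_eq_mul,
    mul_inv_cancel_left₀ hcard, add_comm]
  simp only [hsite]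

/-- For a permutation-invariant function, the absence of correlations between one pair of sites
extends to all pairs. -/
theorem mixed_of_symmetric (F : (Λ → κ) → ℂ)
    (hsymm : ∀ (n : Λ → κ) (σ : Equiv.Perm Λ), F (n ∘ σ) = F n) {x₀ y₀ : Λ} (h₀ : x₀ ≠ y₀)
    (hmixed : ∀ (n : Λ → κ) (a b : κ),
      F (update (update n x₀ a) y₀ b) + F n = F (update n x₀ a) + F (update n y₀ b))
    {x y : Λ} (hxy : x ≠ y) (n : Λ → κ) (a b : κ) :
    F (update (update n x a) y b) + F n = F (update n x a) + F (update n y b) := by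
  obtain ⟨τ, hx, hy⟩ := exists_perm_of_ne hxy h₀
  have hu : ∀ (m : Λ → κ) (z : Λ) (c : κ), update (m ∘ τ.symm) (τ z) c = update m z c ∘ τ.symm := by
    intro m z c
    ext w
    by_cases hw : w = τ z
    · subst hw; simp
    · have : τ.symm w ≠ z := fun e => hw (by rw [← e, Equiv.apply_symm_apply])
      simp [Function.update_of_ne hw, Function.update_of_ne this]
  have h := hmixed (n ∘ τ.symm) a b
  rw [← hx, ← hy] at h
  simpa only [hu, hsymm] using h

end Additive

namespace TargetSpace

variable {d r : ℕ} (T : TargetSpace d r) {Λ : Type*} [Fintype Λ]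

/-! ### Diagonal operators and amplitudes -/

section Diagonal

theorem permute_braConf (τ : Equiv.Perm Λ) (n : Λ → Fin (r + 1)) :
    permute τ (T.braConf n) = T.braConf (n ∘ τ) :=
  permute_tensorVec τ _

/-- The indicator of a label is affine in the weights by `exists_affine`, so the total weight fixes
all occupation numbers, and these determine the product. -/
theorem prod_eq_of_totalWeight {n n' : Λ → Fin (r + 1)}
    (hw : ∀ i, T.totalWeight n i = T.totalWeight n' i) (t : Fin (r + 1) → ℂ) :
    ∏ x, t (n x) = ∏ x, t (n' x) := by
  have hsum : ∀ g : Fin (r + 1) → ℂ, ∑ x, g (n x) = ∑ x, g (n' x) := by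
    intro g
    obtain ⟨b, c, hg⟩ := T.exists_affine g
    have hgen : ∀ m : Λ → Fin (r + 1), ∑ x, g (m x) =
        ∑ i, b i * (T.totalWeight m i : ℂ) + Fintype.card Λ * c := by
      intro m
      simp only [hg, Finset.sum_add_distrib, Finset.sum_const, Finset.card_univ, nsmul_eq_mul,
        totalWeight, Complex.ofReal_sum, Finset.mul_sum]
      rw [Finset.sum_comm]
    rw [hgen, hgen]
    simp only [hw]
  have hcount : ∀ k, (Finset.univ.filter fun x => n x = k).card =
      (Finset.univ.filter fun x => n' x = k).card := by
    intro k
    have := hsum fun j => if j = k then 1 else 0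
    simpa using this
  have hgen : ∀ m : Λ → Fin (r + 1), ∏ x, t (m x) =
      ∏ k, t k ^ (Finset.univ.filter fun x => m x = k).card := by
    intro m
    rw [← Finset.prod_fiberwise Finset.univ m fun x => t (m x)]
    refine Finset.prod_congr rfl fun k _ => ?_
    rw [Finset.prod_congr rfl (g := fun _ => t k), Finset.prod_const]
    intro x hx
    rw [(Finset.mem_filter.mp hx).2]
  rw [hgen n, hgen n']
  simp only [hcount]

variable [DecidableEq Λ]

/-- A resolution of the identity on one site: the orthogonal complement of the target space is
assigned to the label `0`. -/
def level (k : Fin (r + 1)) : Matrix (Fin d) (Fin d) ℂ :=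
  T.dyad k + if k = 0 then 1 - T.proj else 0

theorem sum_smul_level (g : Fin (r + 1) → ℂ) :
    ∑ k, g k • T.level k = ∑ k, g k • T.dyad k + g 0 • (1 - T.proj) := by
  simp [level, Finset.sum_add_distrib]

theorem sum_level : ∑ k, T.level k = 1 := by
  have h := T.sum_smul_level 1
  simp only [Pi.one_apply, one_smul] at h
  rw [h, ← proj]
  abel

theorem level_mulVec_sum (k : Fin (r + 1)) (t : Fin (r + 1) → ℂ) :
    T.level k *ᵥ ∑ j, t j • T.ketVec j = t k • T.ketVec k := by
  have h1 : (1 - T.proj) *ᵥ (∑ j, t j • T.ketVec j) = 0 := by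
    rw [sub_mulVec, one_mulVec, T.proj_mulVec_of_mem (T.mem_vecSpace_iff.mpr ⟨t, rfl⟩), sub_self]
  have h2 : (if k = 0 then 1 - T.proj else 0) *ᵥ (∑ j, t j • T.ketVec j) = 0 := by
    split_ifs
    · exact h1
    · exact zero_mulVec _
  rw [level, add_mulVec, h2, add_zero, dyad_mulVec]
  simp [dotProduct_sum, dotProduct_smul, braVec_dotProduct_ketVec]

/-- The operator that is diagonal with respect to the labels of `level`, with entries `f`. -/
def diagOp (f : (Λ → Fin (r + 1)) → ℂ) : Op Λ d :=
  ∑ n, f n • productOp fun x => T.level (n x)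

theorem diagOp_mulVec (f : (Λ → Fin (r + 1)) → ℂ) (t : Fin (r + 1) → ℂ) :
    T.diagOp f *ᵥ tensorVec (fun _ => ∑ k, t k • T.ketVec k) =
      ∑ n, (f n * ∏ x, t (n x)) • T.ketConf n := by
  rw [diagOp, sum_mulVec]
  refine Finset.sum_congr rfl fun n _ => ?_
  rw [smul_mulVec, productOp_mulVec, mul_smul]
  simp only [level_mulVec_sum]
  congr 1
  exact (tensorVecMultilinear Λ d).map_smul_univ (fun x => t (n x)) fun x => T.ketVec (n x)

theorem diagOp_sum {ι : Type*} (s : Finset ι) (f : ι → (Λ → Fin (r + 1)) → ℂ) :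
    ∑ i ∈ s, T.diagOp (f i) = T.diagOp fun n => ∑ i ∈ s, f i n := by
  simp only [diagOp, Finset.sum_smul]
  exact Finset.sum_comm

/-- Isolates the sum over the label at `y`; the inner sum ignores `n y`, hence the overcount by `r +
1`. -/
theorem sum_config_eq (y : Λ) {M : Type*} [AddCommGroup M] [Module ℂ M]
    (g : (Λ → Fin (r + 1)) → M) :
    ∑ n, g n = ((r + 1 : ℕ) : ℂ)⁻¹ • ∑ n : Λ → Fin (r + 1), ∑ k, g (update n y k) := by
  have hne : ((r + 1 : ℕ) : ℂ) ≠ 0 := by exact_mod_cast Nat.succ_ne_zero r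
  have hinv : Involutive fun p : (Λ → Fin (r + 1)) × Fin (r + 1) => (update p.1 y p.2, p.1 y) := by
    rintro ⟨n, k⟩
    simp
  rw [eq_inv_smul_iff₀ hne, ← Fintype.sum_prod_type' fun n k => g (update n y k),
    ← Equiv.sum_comp hinv.toPerm fun p => g (update p.1 y p.2), Fintype.sum_prod_type]
  simp [← Nat.cast_smul_eq_nsmul ℂ, Finset.smul_sum]

/-- Where `f` ignores the label at `y`, summing over that label gives the identity there by
`sum_level`. Completeness of `level` on all of `ℂ^d`, not just on the target space, is essential
here. -/
theorem supportedOn_diagOp {X : Set Λ} {f : (Λ → Fin (r + 1)) → ℂ}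
    (hf : ∀ y, y ∉ X → ∀ n k, f (update n y k) = f n) : SupportedOn X (T.diagOp f) := by
  refine supportedOn_iff_commute.mpr fun y hy B => ?_
  rw [diagOp, sum_config_eq y]
  refine Commute.smul_left (Commute.sum_left _ _ _ fun n _ => ?_) _
  have h1 : ∑ k, f (update n y k) • productOp (fun x => T.level (update n y k x)) =
      f n • productOp (update (fun x => T.level (n x)) y 1) := by
    rw [← T.sum_level]
    refine Eq.trans ?_ (congrArg _ ((productOpMultilinear Λ d).map_update_sum Finset.univ y
      T.level fun x => T.level (n x)).symm)
    rw [Finset.smul_sum]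
    refine Finset.sum_congr rfl fun k _ => ?_
    rw [hf y hy]
    congr 2
    ext1 x
    by_cases hx : x = y
    · subst hx; simp
    · simp [Function.update_of_ne hx]
  rw [h1]
  exact (commute_productOp_siteOp (by simp)).smul_left _

/-- The summand `ε (n x)` weights only the factor at `x`; at the other sites the levels add up to
the identity. -/
theorem diagOp_additive (ε : Fin (r + 1) → ℂ) :
    T.diagOp (fun n : Λ → Fin (r + 1) => ∑ x, ε (n x)) =
      ∑ x, siteOp x (∑ k, ε k • T.level k) := by
  rw [← T.diagOp_sum Finset.univ fun x n => ε (n x)]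
  refine Finset.sum_congr rfl fun x _ => ?_
  have h1 : siteOp x (∑ k, ε k • T.level k) =
      productOp fun z => ∑ k, (if z = x then ε k else 1) • T.level k := by
    rw [siteOp]
    congr 1
    ext1 z
    by_cases hz : z = x
    · subst hz; simp
    · simp [hz, T.sum_level]
  rw [h1]
  refine Eq.trans ?_ ((productOpMultilinear Λ d).map_sum
    fun z k => (if z = x then ε k else 1) • T.level k).symm
  refine Finset.sum_congr rfl fun n _ => ?_
  refine Eq.trans ?_ ((productOpMultilinear Λ d).map_smul_univ
    (fun z => if z = x then ε (n z) else 1) fun z => T.level (n z)).symm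
  rw [Finset.prod_ite_eq' Finset.univ x fun z => ε (n z), if_pos (Finset.mem_univ x)]
  rfl

/-- The amplitude of `O (∑_n |n⟩)` on the configuration `n`. -/
def amplitude (O : Op Λ d) (n : Λ → Fin (r + 1)) : ℂ :=
  T.braConf n ⬝ᵥ (O *ᵥ tensorVec fun _ => ∑ k, T.ketVec k)

theorem amplitude_sum {ι : Type*} (s : Finset ι) (O : ι → Op Λ d) (n : Λ → Fin (r + 1)) :
    T.amplitude (∑ i ∈ s, O i) n = ∑ i ∈ s, T.amplitude (O i) n := by
  simp only [amplitude, sum_mulVec, dotProduct_sum]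

theorem amplitude_zero (n : Λ → Fin (r + 1)) : T.amplitude (0 : Op Λ d) n = 0 := by
  simp [amplitude]

/-- The one-site operator `B = 1 + |n_y⟩(⟨b| - ⟨n_y|)` turns `⟨n_y|` into `⟨b|` yet fixes `∑_k |k⟩`,
because both bras have overlap one with it. As `B` commutes with `O`, it moves from the bra to the
ket and disappears. -/
theorem amplitude_update {X : Set Λ} {O : Op Λ d} (hO : SupportedOn X O) {y : Λ} (hy : y ∉ X)
    (n : Λ → Fin (r + 1)) (b : Fin (r + 1)) :
    T.amplitude O (update n y b) = T.amplitude O n := by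
  set B : Matrix (Fin d) (Fin d) ℂ :=
    1 + vecMulVec (T.ketVec (n y)) (T.braVec b - T.braVec (n y)) with hB
  have hbra : T.braConf (update n y b) = T.braConf n ᵥ* siteOp y B := by
    rw [braConf, braConf, vecMul_siteOp]
    congr 1
    ext1 x
    by_cases hx : x = y
    · subst hx
      simp [hB, vecMul_add, vecMul_vecMulVec, braVec_dotProduct_ketVec]
    · simp [Function.update_of_ne hx]
  have hket : siteOp y B *ᵥ tensorVec (fun _ : Λ => ∑ k, T.ketVec k) =
      tensorVec fun _ => ∑ k, T.ketVec k := by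
    rw [siteOp_mulVec]
    congr 1
    rw [Function.update_eq_self_iff, hB, add_mulVec, one_mulVec, vecMulVec_mulVec]
    simp [sub_dotProduct, dotProduct_sum, braVec_dotProduct_ketVec]
  rw [amplitude, hbra, ← dotProduct_mulVec, mulVec_mulVec,
    ← (supportedOn_iff_commute.mp hO y hy B).eq, ← mulVec_mulVec, hket, amplitude]

/-- `H` maps the uniform product state to a combination of weight states, which is permutation
invariant. -/
theorem amplitude_comp_perm {H : Op Λ d}
    (heig : ∀ k : Λ → Fin (r + 1), ∃ E : ℂ, H *ᵥ T.weightState k = E • T.weightState k)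
    (n : Λ → Fin (r + 1)) (τ : Equiv.Perm Λ) : T.amplitude H (n ∘ τ) = T.amplitude H n := by
  obtain ⟨a, ha⟩ := T.exists_mulVec_tensorVec heig 1
  simp only [Pi.one_apply, one_smul] at ha
  have hinv : permute τ (∑ k, a k • T.weightState k) = ∑ k, a k • T.weightState k := by
    rw [← permOp_mulVec, mulVec_sum]
    simp only [mulVec_smul, permOp_mulVec, (T.weightState_mem_symSpace _).2 τ]
  rw [amplitude, amplitude, ha, ← permute_braConf]
  conv_lhs => rw [← hinv]
  exact Fintype.sum_equiv (Equiv.arrowCongr τ (Equiv.refl _)) _ _ fun m => rfl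

theorem cartanOn_mulVec_ketConf (i : Fin r) (n : Λ → Fin (r + 1)) :
    T.cartanOn Finset.univ i *ᵥ T.ketConf n = (T.totalWeight n i : ℂ) • T.ketConf n := by
  rw [cartanOn, sum_mulVec, totalWeight, Complex.ofReal_sum, Finset.sum_smul]
  refine Finset.sum_congr rfl fun x _ => ?_
  rw [ketConf, siteOp_mulVec, cartan_mulVec_ketVec]
  refine ((tensorVecMultilinear Λ d).map_update_smul _ x _ _).trans ?_
  rw [Function.update_eq_self]
  rfl

theorem braConf_vecMul_cartanOn (i : Fin r) (n : Λ → Fin (r + 1)) :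
    T.braConf n ᵥ* T.cartanOn Finset.univ i = (T.totalWeight n i : ℂ) • T.braConf n := by
  rw [cartanOn, vecMul_sum, totalWeight, Complex.ofReal_sum, Finset.sum_smul]
  refine Finset.sum_congr rfl fun x _ => ?_
  rw [braConf, vecMul_siteOp, braVec_vecMul_cartan]
  refine ((tensorVecMultilinear Λ d).map_update_smul _ x _ _).trans ?_
  rw [Function.update_eq_self]
  rfl

/-- A weight-preserving term acts on symmetric product states as a diagonal operator. -/
theorem projOn_mul_mulVec_eq_diagOp {X : Finset Λ} {O : Op Λ d}
    (hO : SupportedOn (X : Set Λ) O)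
    (hweight : ∀ i, Commute (T.projOn X * O * T.projOn X) (T.cartanOn X i))
    {v : Fin d → ℂ} (hv : v ∈ T.vecSpace) :
    (T.projOn X * O) *ᵥ tensorVec (fun _ => v) =
      T.diagOp (T.amplitude O) *ᵥ tensorVec fun _ => v := by
  set B := T.projOn X * O * T.projOn X with hB
  have hBsupp : SupportedOn (X : Set Λ) B :=
    ((T.supportedOn_projOn X).mul hO).mul (T.supportedOn_projOn X)
  have hBcomm : ∀ i, Commute B (T.cartanOn Finset.univ i) := by
    intro i
    rw [cartanOn, ← Finset.sum_add_sum_compl X]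
    refine (hweight i).add_right (Commute.sum_right _ _ _ fun y hy => ?_)
    exact supportedOn_iff_commute.mp hBsupp y (by simpa using hy) _
  have hBv : ∀ w ∈ T.vecSpace, B *ᵥ tensorVec (fun _ => w) =
      (T.projOn X * O) *ᵥ tensorVec (fun _ => w) := by
    intro w hw
    rw [hB, ← mulVec_mulVec, T.projOn_mulVec_tensorVec X fun _ _ => hw]
  -- The output lies in the target space on `X` because of the left factor `P_X` in `B`, and off `X`
  -- because `B` leaves the state untouched there.
  have hproj : T.projOn Finset.univ *ᵥ (B *ᵥ tensorVec fun _ => v) = B *ᵥ tensorVec fun _ => v := by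
    have h1 : (T.projOn Finset.univ : Op Λ d) * B = B * T.projOn Xᶜ := by
      have h2 : (T.projOn Finset.univ : Op Λ d) = T.projOn Xᶜ * T.projOn X := by
        rw [projOn_mul_projOn, Finset.union_comm, Finset.union_compl]
      have h3 : T.projOn X * B = B := by
        rw [hB, ← mul_assoc, ← mul_assoc, projOn_mul_projOn, Finset.union_self]
      rw [h2, mul_assoc, h3]
      exact (T.commute_projOn hBsupp (by simp)).eq.symm
    rw [mulVec_mulVec, h1, ← mulVec_mulVec, T.projOn_mulVec_tensorVec _ fun _ _ => hv]
  -- Configurations are eigenvectors of the total generators, with which `B` commutes; so different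
  -- total weights are not connected.
  have hoff : ∀ n n' : Λ → Fin (r + 1), T.braConf n ⬝ᵥ (B *ᵥ T.ketConf n') ≠ 0 →
      ∀ i, T.totalWeight n i = T.totalWeight n' i := by
    intro n n' hne i
    have h1 : T.braConf n ⬝ᵥ ((B * T.cartanOn Finset.univ i) *ᵥ T.ketConf n') =
        T.braConf n ⬝ᵥ ((T.cartanOn Finset.univ i * B) *ᵥ T.ketConf n') := by
      rw [(hBcomm i).eq]
    rw [← mulVec_mulVec _ B, cartanOn_mulVec_ketConf, mulVec_smul, dotProduct_smul,
      ← mulVec_mulVec _ (T.cartanOn _ _) B, dotProduct_mulVec _ (T.cartanOn _ _),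
      braConf_vecMul_cartanOn, smul_dotProduct] at h1
    exact_mod_cast (smul_left_injective ℂ hne h1).symm
  obtain ⟨t, rfl⟩ := T.mem_vecSpace_iff.mp hv
  rw [← hBv _ hv, T.eq_sum_of_projOn_univ hproj, diagOp_mulVec]
  refine Finset.sum_congr rfl fun n _ => ?_
  congr 1
  have hone : (∑ k, T.ketVec k) = ∑ k, (1 : Fin (r + 1) → ℂ) k • T.ketVec k := by simp
  have hamp : T.amplitude O n = ∑ n', T.braConf n ⬝ᵥ (B *ᵥ T.ketConf n') := by
    have h1 : T.amplitude O n = T.braConf n ⬝ᵥ (B *ᵥ tensorVec fun _ => ∑ k, T.ketVec k) := by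
      rw [hBv _ (T.mem_vecSpace_iff.mpr ⟨1, hone⟩), ← mulVec_mulVec, dotProduct_mulVec,
        braConf_vecMul_projOn, amplitude]
    rw [h1, hone, tensorVec_sum_smul_ketVec]
    simp [mulVec_sum, dotProduct_sum]
  rw [tensorVec_sum_smul_ketVec, mulVec_sum, dotProduct_sum, hamp, Finset.sum_mul]
  refine Finset.sum_congr rfl fun n' _ => ?_
  rw [mulVec_smul, dotProduct_smul, smul_eq_mul]
  -- Where the matrix element is non-zero, `n'` and `n` carry the same product of coefficients,
  -- which therefore factors out of the sum over `n'`.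
  by_cases hne : T.braConf n ⬝ᵥ (B *ᵥ T.ketConf n') = 0
  · rw [hne, mul_zero, zero_mul]
  · rw [T.prod_eq_of_totalWeight (hoff n n' hne) t, mul_comm]

end Diagonal

end TargetSpace

end FerroScar

namespace FerroScar

open Function Finset Matrix

namespace TargetSpace

variable {d r : ℕ} (T : TargetSpace d r) {Λ : Type*} [Fintype Λ] [DecidableEq Λ]

/-! ### The Zeeman term, its energies and its Hermiticity -/

section Zeeman

theorem sum_smul_cartan {b : Fin r → ℂ} {c : ℂ} {ε : Fin (r + 1) → ℂ}
    (hε : ∀ k, ε k = ∑ i, b i * (T.weight k i : ℂ) + c) :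
    ∑ i, b i • T.cartan i = ∑ k, (ε k - c) • T.dyad k := by
  simp only [cartan, Finset.smul_sum, smul_smul]
  rw [Finset.sum_comm]
  refine Finset.sum_congr rfl fun k _ => ?_
  rw [← Finset.sum_smul, hε k, add_sub_cancel_right]

theorem zeeman_eq_sum_siteOp (b : Fin r → ℂ) (c : ℂ) :
    T.zeeman Λ b c = ∑ x, siteOp x (∑ i, b i • T.cartan i + c • 1) := by
  refine Finset.sum_congr rfl fun x _ => ?_
  simp only [siteOp_add, siteOp_sum, siteOp_smul, siteOp_one]

/-- On the target space the one-site operators agree. On its complement `level` assigns the value `ε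
0`, while the generators vanish and leave `c`. -/
theorem sum_siteOp_level_sub_zeeman {b : Fin r → ℂ} {c : ℂ} {ε : Fin (r + 1) → ℂ}
    (hε : ∀ k, ε k = ∑ i, b i * (T.weight k i : ℂ) + c) :
    ∑ x : Λ, siteOp x (∑ k, ε k • T.level k) - T.zeeman Λ b c =
      ∑ x, (ε 0 - c) • T.leakProj x := by
  rw [zeeman_eq_sum_siteOp, ← Finset.sum_sub_distrib]
  refine Finset.sum_congr rfl fun x _ => ?_
  rw [leakProj, ← siteOp_smul, ← siteOp_sub, sum_smul_level, T.sum_smul_cartan hε]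
  congr 1
  simp only [sub_smul, Finset.sum_sub_distrib, ← Finset.smul_sum, smul_sub]
  rw [← proj]
  abel

theorem zeeman_mulVec_ketConf (b : Fin r → ℂ) (c : ℂ) (n : Λ → Fin (r + 1)) :
    T.zeeman Λ b c *ᵥ T.ketConf n =
      (∑ i, b i * (T.totalWeight n i : ℂ) + Fintype.card Λ * c) • T.ketConf n := by
  have h : T.zeeman Λ b c =
      ∑ i, b i • T.cartanOn Finset.univ i + ((Fintype.card Λ : ℂ) * c) • 1 := by
    simp only [zeeman, cartanOn, Finset.sum_add_distrib, Finset.smul_sum]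
    rw [Finset.sum_comm, Finset.sum_const, Finset.card_univ, mul_smul, Nat.cast_smul_eq_nsmul]
  rw [h, add_mulVec, sum_mulVec, smul_mulVec, one_mulVec, add_smul, Finset.sum_smul]
  simp only [smul_mulVec, cartanOn_mulVec_ketConf, smul_smul]

theorem zeeman_mulVec_weightState (b : Fin r → ℂ) (c : ℂ) (k : Λ → Fin (r + 1)) :
    T.zeeman Λ b c *ᵥ T.weightState k =
      (∑ i, b i * (T.totalWeight k i : ℂ) + Fintype.card Λ * c) • T.weightState k := by
  have hw : ∀ (σ : Equiv.Perm Λ) i, T.totalWeight (fun x => k (σ x)) i = T.totalWeight k i :=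
    fun σ i => Equiv.sum_comp σ fun x => T.weight (k x) i
  rw [weightState_eq, mulVec_sum, Finset.smul_sum]
  refine Finset.sum_congr rfl fun σ _ => ?_
  have h := T.zeeman_mulVec_ketConf b c fun x => k (σ x)
  simp only [hw] at h
  exact h

/-- For a polarized state all permuted copies coincide, and the overlap is `N!`. -/
theorem braConf_dotProduct_weightState_ne_zero (j : Fin (r + 1)) :
    T.braConf (fun _ : Λ => j) ⬝ᵥ T.weightState (fun _ => j) ≠ 0 := by
  rw [weightState_eq, dotProduct_sum]
  simp [braConf, tensorVec_dotProduct, braVec_dotProduct_ketVec, Nat.factorial_ne_zero,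
    Fintype.card_perm]

/-- If a Hermitian operator has the same scar energies as the Zeeman term, then the Zeeman term is
Hermitian. -/
theorem isHermitian_zeeman {b : Fin r → ℂ} {c : ℂ} {H : Op Λ d} (hH : H.IsHermitian)
    (heig : ∀ k : Λ → Fin (r + 1), H *ᵥ T.weightState k =
      (∑ i, b i * (T.totalWeight k i : ℂ) + Fintype.card Λ * c) • T.weightState k) :
    (T.zeeman Λ b c).IsHermitian := by
  rcases isEmpty_or_nonempty Λ with hΛ | hΛ
  · simp [zeeman, Matrix.IsHermitian]
  have hcard : (Fintype.card Λ : ℂ) ≠ 0 := by exact_mod_cast Fintype.card_ne_zero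
  set ε : Fin (r + 1) → ℂ := fun k => ∑ i, b i * (T.weight k i : ℂ) + c with hε
  -- The state polarized along `j` has energy `N * ε j`, which is real since `H` is Hermitian.
  have hreal : ∀ j, star (ε j) = ε j := by
    intro j
    set ψ := T.weightState (fun _ : Λ => j) with hψ
    have h1 : H *ᵥ ψ = ((Fintype.card Λ : ℂ) * ε j) • ψ := by
      rw [hψ, heig]
      congr 1
      simp only [hε, totalWeight, Finset.sum_const, Finset.card_univ, mul_add, Finset.mul_sum]
      congr 1
      refine Finset.sum_congr rfl fun i _ => ?_
      push_cast [nsmul_eq_mul]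
      ring
    have hne : star ψ ⬝ᵥ ψ ≠ 0 := by
      intro h0
      have hψ0 : ψ = 0 := by open scoped ComplexOrder in exact dotProduct_star_self_eq_zero.mp h0
      apply T.braConf_dotProduct_weightState_ne_zero (Λ := Λ) j
      rw [← hψ, hψ0, dotProduct_zero]
    have h2 : star (H *ᵥ ψ) ⬝ᵥ ψ = star ψ ⬝ᵥ (H *ᵥ ψ) := by
      rw [star_mulVec, hH.eq, dotProduct_mulVec]
    rw [h1, star_smul, smul_dotProduct, dotProduct_smul] at h2
    have h3 := smul_left_injective ℂ hne h2
    rw [star_mul', star_natCast] at h3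
    exact mul_left_cancel₀ hcard h3
  -- Tracelessness gives `∑ k, ε k = (r + 1) * c`.
  have hc : star c = c := by
    have hr : ((r + 1 : ℕ) : ℂ) ≠ 0 := by exact_mod_cast Nat.succ_ne_zero r
    have h1 : ∑ k, ε k = ((r + 1 : ℕ) : ℂ) * c := by
      simp only [hε, Finset.sum_add_distrib]
      rw [Finset.sum_comm]
      have h2 : ∀ i, ∑ k, (T.weight k i : ℂ) = 0 := fun i => by
        exact_mod_cast congrArg (fun z : ℝ => (z : ℂ)) (T.weight_sum i)
      simp [← Finset.mul_sum, h2]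
    have h3 : star (((r + 1 : ℕ) : ℂ) * c) = ((r + 1 : ℕ) : ℂ) * c := by
      rw [← h1, star_sum]
      simp only [hreal]
    rw [star_mul', star_natCast] at h3
    exact mul_left_cancel₀ hr h3
  rw [Matrix.IsHermitian, zeeman_eq_sum_siteOp, conjTranspose_sum]
  refine Finset.sum_congr rfl fun x _ => ?_
  rw [siteOp_conjTranspose, T.sum_smul_cartan (ε := ε) (c := c) fun k => rfl]
  congr 1
  simp only [conjTranspose_add, conjTranspose_sum, conjTranspose_smul, dyad_conjTranspose,
    conjTranspose_one, star_sub, hreal, hc]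

end Zeeman

/-! ### Assembly of the decomposition -/

section Main

variable {T} {G : SimpleGraph Λ} {h : Finset Λ → Op Λ d}

theorem exists_amplitude_eq_sum (hloc : IsLocal G h)
    (heig : ∀ k : Λ → Fin (r + 1), ∃ E : ℂ,
      (∑ X, h X) *ᵥ T.weightState k = E • T.weightState k) :
    ∃ ε : Fin (r + 1) → ℂ, ∀ n, T.amplitude (∑ X, h X) n = ∑ x, ε (n x) := by
  rcases isEmpty_or_nonempty Λ with hΛ | hΛ
  · refine ⟨0, fun n => ?_⟩
    -- Without sites the sum is empty, so the amplitude must vanish; it does because interaction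
    -- regions are non-empty.
    have h0 : ∀ X, h X = 0 := by
      intro X
      by_contra hX
      obtain ⟨x, -⟩ := (hloc.connected X hX).nonempty
      exact hΛ.elim x
    simp [h0, amplitude_zero]
  have hsymm := T.amplitude_comp_perm heig
  refine exists_eq_sum_of_symmetric _ hsymm fun x y hxy => ?_
  -- The pair `x ≠ y` shows that there are two sites; on a single site there is nothing to check.
  -- Every non-zero `h X` misses `x₀` or `y₀`, so its amplitude ignores that label and has no mixed
  -- difference.
  obtain ⟨x₀, y₀, h₀, hxy₀⟩ := hloc.not_all_to_all ⟨x, y, hxy⟩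
  refine mixed_of_symmetric _ hsymm h₀ (fun n a b => ?_) hxy
  simp only [amplitude_sum, ← Finset.sum_add_distrib]
  refine Finset.sum_congr rfl fun X _ => ?_
  by_cases hX : h X = 0
  · simp [hX, amplitude_zero]
  rcases not_and_or.mp (hxy₀ X hX) with hx | hy
  · rw [Function.update_comm h₀, T.amplitude_update (hloc.supported X) (y := x₀) hx,
      T.amplitude_update (hloc.supported X) (y := x₀) hx, add_comm]
  · rw [T.amplitude_update (hloc.supported X) (y := y₀) hy,
      T.amplitude_update (hloc.supported X) (y := y₀) hy]

variable [DecidableRel G.Adj]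

/-- Both operators act only on `X` and agree on all symmetric product states. -/
theorem decomposes_projOn_mul_sub_diagOp (hloc : IsLocal G h) {X : Finset Λ}
    (hweight : ∀ i, Commute (T.projOn X * h X * T.projOn X) (T.cartanOn X i)) :
    Decomposes T G h (T.projOn X * h X - T.diagOp (T.amplitude (h X))) := by
  by_cases hX : h X = 0
  · have h0 : T.diagOp (T.amplitude (0 : Op Λ d)) = 0 := by simp [diagOp, amplitude_zero]
    rw [hX, mul_zero, h0, sub_zero]
    exact Decomposes.zero
  have hconn := hloc.connected X hX
  obtain ⟨x₀, hx₀⟩ := hconn.nonempty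
  refine decomposes_of_annihilates ⟨x₀, hx₀⟩ hconn.preconnected
    (fun x hx z hz => ⟨X, X, hX, hX, hx, hz, x, hx, hx⟩) ?_ fun v hv => ?_
  · refine ((T.supportedOn_projOn X).mul (hloc.supported X)).sub (T.supportedOn_diagOp ?_)
    exact fun y hy n k => T.amplitude_update (hloc.supported X) hy n k
  · rw [sub_mulVec, T.projOn_mul_mulVec_eq_diagOp (hloc.supported X) hweight hv, sub_self]

/-- Telescopes through `∑ P_X h_X` and the diagonal operator of the total amplitude, each of the
three differences being decomposable. -/
theorem exists_decomposes_sub_zeeman (hloc : IsLocal G h)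
    (heig : ∀ k : Λ → Fin (r + 1), ∃ E : ℂ,
      (∑ X, h X) *ᵥ T.weightState k = E • T.weightState k)
    (hweight : ∀ (X : Finset Λ) (i : Fin r),
      Commute (T.projOn X * h X * T.projOn X) (T.cartanOn X i)) :
    ∃ (b : Fin r → ℂ) (c : ℂ), Decomposes T G h (∑ X, h X - T.zeeman Λ b c) := by
  obtain ⟨ε, hε⟩ := exists_amplitude_eq_sum hloc heig
  obtain ⟨b, c, hbc⟩ := T.exists_affine ε
  refine ⟨b, c, ?_⟩
  have h1 := decomposes_sub_sum_projOn_mul hloc heig Finset.univ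
  simp only [Finset.inter_univ] at h1
  have h2 := Decomposes.sum (s := Finset.univ) fun X _ =>
    decomposes_projOn_mul_sub_diagOp hloc (hweight X)
  rw [Finset.sum_sub_distrib, diagOp_sum] at h2
  simp only [← amplitude_sum, hε] at h2
  rw [diagOp_additive] at h2
  have h3 : Decomposes T G h (∑ x : Λ, siteOp x (∑ k, ε k • T.level k) - T.zeeman Λ b c) := by
    rw [T.sum_siteOp_level_sub_zeeman hbc]
    exact Decomposes.sum fun x _ => Decomposes.smul_leakProj _ x
  have h4 := (h1.add h2).add h3
  rwa [sub_add_sub_cancel, sub_add_sub_cancel] at h4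

end Main

end TargetSpace

end FerroScar

theorem mainTheorem5 {Λ : Type*} [Fintype Λ] [DecidableEq Λ] (G : SimpleGraph Λ)
    [DecidableRel G.Adj] {d r : ℕ} (T : TargetSpace d r)
    (h : Finset Λ → Op Λ d) (H : Op Λ d) (hH : H = ∑ X, h X)
    (hloc : IsLocal G h)
    (heig : ∀ k : Λ → Fin (r + 1), ∃ E : ℂ, H.mulVec (T.weightState k) = E • T.weightState k)
    (hweight : ∀ (X : Finset Λ) (i : Fin r),
      Commute (T.projOn X * h X * T.projOn X) (T.cartanOn X i)) :
    ∃ (P₁ h₁ : Λ → Op Λ d) (P₂ h₂ : Sym2 Λ → Op Λ d) (b : Fin r → ℂ) (c : ℂ),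
      H = ∑ x, h₁ x * P₁ x + ∑ e ∈ G.edgeFinset, h₂ e * P₂ e + T.zeeman Λ b c ∧
      (∀ x, T.IsLocalAnnihilatingProjector {x} (P₁ x)) ∧
      (∀ e ∈ G.edgeFinset, T.IsLocalAnnihilatingProjector {z | z ∈ e} (P₂ e)) ∧
      (∀ x, SupportedOn (interactionHull h x) (h₁ x)) ∧
      (∀ e ∈ G.edgeFinset, SupportedOn {z | ∀ x ∈ e, z ∈ interactionHull h x} (h₂ e)) ∧
      (H.IsHermitian → (T.zeeman Λ b c).IsHermitian) ∧
      ∀ k : Λ → Fin (r + 1), ∃ E : ℂ,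
        E = ∑ i, b i * (T.totalWeight k i : ℂ) + Fintype.card Λ * c ∧
        (T.zeeman Λ b c).mulVec (T.weightState k) = E • T.weightState k ∧
        H.mulVec (T.weightState k) = E • T.weightState k := by

  subst hH
  obtain ⟨b, c, h₁, h₂, hdec, hs₁, hs₂⟩ :=
    TargetSpace.exists_decomposes_sub_zeeman hloc heig hweight
  have hP₁ := T.isLocalAnnihilatingProjector_leakProj (Λ := Λ)
  have hP₂ := T.isLocalAnnihilatingProjector_edgeProj (Λ := Λ)
  rw [sub_eq_iff_eq_add] at hdec
  have hscar : ∀ k : Λ → Fin (r + 1), (∑ X, h X).mulVec (T.weightState k) =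
      (∑ i, b i * (T.totalWeight k i : ℂ) + Fintype.card Λ * c) • T.weightState k := by
    intro k
    have hk := T.weightState_mem_symSpace k
    rw [hdec, Matrix.add_mulVec, Matrix.add_mulVec, Matrix.sum_mulVec, Matrix.sum_mulVec,
      T.zeeman_mulVec_weightState, Finset.sum_eq_zero, Finset.sum_eq_zero, zero_add, zero_add]
    · intro e _
      rw [← Matrix.mulVec_mulVec, (hP₂ e).2.2 _ hk, Matrix.mulVec_zero]
    · intro x _
      rw [← Matrix.mulVec_mulVec, (hP₁ x).2.2 _ hk, Matrix.mulVec_zero]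
  exact ⟨T.leakProj, h₁, edgeProj Λ d, h₂, b, c, hdec, hP₁, fun e _ => hP₂ e, hs₁, hs₂,
    fun hHerm => T.isHermitian_zeeman hHerm hscar,
    fun k => ⟨_, rfl, T.zeeman_mulVec_weightState b c k, hscar k⟩⟩
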